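/- Let $S$ be a countable set (e.g. $S=\{0,1,2,\dots\}$) and $U$ a nonempty compact metric space. For $i\ne j$ in $S$ let $\lambda_{ij}:[0,\infty)\times U\to[0,\infty)$ be jointly continuous, with $\sum_{j\ne i}\lambda_{ij}(y,u)$ converging uniformly in $(y,u)$ for each $i$, and assume there are constants $0<m<M<\infty$ with $$m<\inf_{i,y,u}\sum_{j\ne i}\lambda_{ij}(y,u),\qquad \sup_{i,y,u}\sum_{j\ne i}\lambda_{ij}(y,u)<M .$$ Let $c:S\times[0,\infty)\times U\to[0,\infty)$ be a bounded running cost, continuous in its second and in its third variable. Let $\mathcal P(U)$ be the set of Borel probability measures on $U$, $\mathcal R$ the set of measurable maps $r:[0,\infty)\to\mathcal P(U)$, $y\mapsto r_y$, and $\mathcal U$ the set of admissible controls, i.e. of measurable maps $\mathbf u:S\times[0,\infty)\to\mathcal P(U)$. For $\mathbf u\in\mathcal U$ let $(X_t,Y_t)_{t\ge0}$ be the controlled process with state $X_t$ and age $Y_t$ (the time since the last jump) started at $(i,0)$: in state $k$ at age $y$ it jumps to $(j,0)$, $j\neq k$, at rate $\int_U\lambda_{kj}(y,v)\,\mathbf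 u(k,y)(dv)$, and between jumps $X$ is constant and $Y$ grows at unit speed. Equivalently, after a jump into $k$, the next state is $j$ and the sojourn time lies in $dt$ with probability $$\exp\Bigl\{-\int_0^t\int_U\sum_{l\ne k}\lambda_{kl}(s,v)\,\mathbf u(k,s)(dv)\,ds\Bigr\}\int_U\lambda_{kj}(t,v)\,\mathbf u(k,t)(dv)\,dt ,$$ independently of the past. Let $T_n$ be the $n$-th jump time and $$J^{\mathbf u}(i)=\limsup_{n\to\infty}\frac{\mathbb E^{\mathbf u}_{i,0}\int_0^{T_n}\int_U c(X_t,Y_t,v)\,\mathbf u(X_t,Y_t)(dv)\,dt}{\mathbb E^{\mathbf u}_{i,0}T_n}.$$ For $i\neq j$ in $S$ and $r\in\mathcal R$ put $\Sigma_i^r(y)=\exp\{-\int_0^y\int_U\sum_{k\ne i}\lambda_{ik}(s,v)\,r_s(dv)\,ds\}$ and $$\varphi(i,r)=\int_0^\infty\Sigma_i^r(y)\int_U c(i,y,v)\,r_y(dv)\,dy,\quad \hat p_{ij}(r)=\int_0^\infty\Sigma_i^r(y)\int_U\lambda_{ij}(y,v)\,r_y(dv)\,dy,\quad \bar\tau(i,r)=\int_0^\infty\Sigma_i^r(y)\,dy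 .$$ Suppose that a bounded function $h:S\to\mathbb R$ and a number $g\in\mathbb R$ solve the average cost equation $$h(i)=\inf_{r\in\mathcal R}\Bigl[\varphi(i,r)+\sum_{j\ne i}\hat p_{ij}(r)h(j)-g\,\bar\tau(i,r)\Bigr]\qquad\text{for all } i\in S .$$ Then: 1. $g$ is the optimal average cost: $\inf_{\mathbf u\in\mathcal U}J^{\mathbf u}(i)=g$ for every $i\in S$. 2. For every $i\in S$ there is $r^*_i\in\mathcal R$ that attains the infimum on the right-hand side. 3. For every family $(r^*_i)_{i\in S}$ of elements of $\mathcal R$ that attain these infima, the control $\mathbf u^*(i,y)=r^*_i(y)$ is average-optimal: $J^{\mathbf u^*}(i)=\inf_{\mathbf u\in\mathcal U}J^{\mathbf u}(i)$ for every $i\in S$. -/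

import Mathlib

open MeasureTheory ProbabilityTheory Filter Set
open scoped ENNReal NNReal Topology

namespace AgeControl

noncomputable section

/-- Lebesgue measure on the half line `[0, ∞)`. -/
def leb : Measure ℝ≥0 := (volume : Measure ℝ).comap ((↑) : ℝ≥0 → ℝ)

/-- `∫ f` over `[0, ∞)` is the integral over the positive reals. -/
theorem lintegral_leb (f : ℝ≥0 → ℝ≥0∞) :
    ∫⁻ t, f t ∂leb = ∫⁻ x in Ioi (0 : ℝ), f x.toNNReal := by
  have hs : MeasurableSet (Ici (0 : ℝ)) := measurableSet_Ici
  have h := lintegral_subtype_comap (μ := volume) hs (fun x : ℝ => f x.toNNReal)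
  rw [← setLIntegral_congr (Ioi_ae_eq_Ici (a := (0 : ℝ)) (μ := volume))] at h
  rw [← h]
  refine lintegral_congr fun t => ?_
  exact congrArg f (Real.toNNReal_coe (r := t)).symm

/-- A density with hazard rate `q` has total mass one if `q` is bounded and bounded away from
zero. -/
theorem lintegral_hazard {q : ℝ≥0 → ℝ≥0∞} (hq : Measurable q) {m K : ℝ≥0} (hm : 0 < m)
    (hmq : ∀ t, (m : ℝ≥0∞) ≤ q t) (hqK : ∀ t, q t ≤ K) :
    ∫⁻ t, ENNReal.ofReal (Real.exp (-(∫⁻ s in Iio t, q s ∂leb).toReal)) * q t ∂leb = 1 := by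
  set f : ℝ → ℝ := fun x => (q x.toNNReal).toReal with hf
  have hqtop : ∀ t, q t ≠ ⊤ := fun t => ((hqK t).trans_lt ENNReal.coe_lt_top).ne
  have hfm : Measurable f := (hq.comp measurable_real_toNNReal).ennreal_toReal
  have hf0 : ∀ x, 0 ≤ f x := fun x => ENNReal.toReal_nonneg
  have hfK : ∀ x, f x ≤ K := fun x => by
    have := ENNReal.toReal_mono ENNReal.coe_ne_top (hqK x.toNNReal)
    simpa using this
  have hfl : ∀ x, (m : ℝ) ≤ f x := fun x => by
    have := ENNReal.toReal_mono (hqtop _) (hmq x.toNNReal)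
    simpa using this
  have hint : ∀ a b : ℝ, IntervalIntegrable f volume a b := fun a b => by
    rw [intervalIntegrable_iff]
    refine Measure.integrableOn_of_bounded (M := K) (by simp) hfm.aestronglyMeasurable ?_
    exact Eventually.of_forall fun x => by
      rw [Real.norm_of_nonneg (hf0 x)]; exact hfK x
  set Q : ℝ → ℝ := fun x => ∫ s in (0 : ℝ)..x, f s with hQ
  have hQeq : ∀ x : ℝ, 0 ≤ x → (∫⁻ s in Iio x.toNNReal, q s ∂leb).toReal = Q x := by
    intro x hx
    have h1 : ∫⁻ s in Iio x.toNNReal, q s ∂leb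
        = ∫⁻ s in Ioc 0 x, ENNReal.ofReal (f s) := by
      rw [← lintegral_indicator measurableSet_Iio, lintegral_leb,
        ← setLIntegral_congr (Ioo_ae_eq_Ioc (a := (0 : ℝ)) (b := x) (μ := volume)),
        ← lintegral_indicator measurableSet_Ioi, ← lintegral_indicator measurableSet_Ioo]
      refine lintegral_congr fun s => ?_
      by_cases h0 : 0 < s
      · by_cases h2 : s < x
        · have h3 : s.toNNReal < x.toNNReal := (Real.toNNReal_lt_toNNReal_iff (h0.trans h2)).2 h2
          simp [indicator, h0, h2, h3, hf, ENNReal.ofReal_toReal (hqtop _)]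
        · have h3 : ¬ s.toNNReal < x.toNNReal := by
            rw [not_lt]; exact Real.toNNReal_le_toNNReal (not_lt.1 h2)
          simp [indicator, h2, h3]
      · simp [indicator, h0]
    rw [h1, hQ]
    simp only
    rw [intervalIntegral.integral_of_le hx, integral_eq_lintegral_of_nonneg_ae
      (Eventually.of_forall hf0) hfm.aestronglyMeasurable]
  have hloc : LocallyIntegrable f volume :=
    (locallyIntegrable_const (K : ℝ)).mono hfm.aestronglyMeasurable
      (Eventually.of_forall fun x => by
        rw [Real.norm_of_nonneg (hf0 x)]
        exact (hfK x).trans (le_abs_self _))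
  have hQder : ∀ᵐ x, HasDerivAt Q (f x) x :=
    (_root_.LocallyIntegrable.ae_hasDerivAt_integral hloc).mono fun x hx => hx 0
  have hQdiff : ∀ x y, Q y - Q x = ∫ s in x..y, f s := fun x y =>
    intervalIntegral.integral_interval_sub_left (hint _ _) (hint _ _)
  have hQlb : ∀ x, 0 ≤ x → (m : ℝ) * x ≤ Q x := by
    intro x hx
    have := intervalIntegral.integral_mono_on hx (intervalIntegrable_const (c := (m : ℝ)))
      (hint 0 x) (fun s _ => hfl s)
    simp only [intervalIntegral.integral_const, smul_eq_mul, sub_zero] at this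
    rw [mul_comm]; exact this
  have hQlip : LipschitzWith K Q := by
    refine LipschitzWith.of_dist_le_mul fun x y => ?_
    rw [Real.dist_eq, Real.dist_eq, hQdiff]
    have := intervalIntegral.norm_integral_le_of_norm_le_const (a := y) (b := x) (f := f)
      (C := K) (fun s _ => by rw [Real.norm_of_nonneg (hf0 s)]; exact hfK s)
    simpa using this
  have hcont : Continuous Q := hQlip.continuous
  set G : ℝ → ℝ := fun x => Real.exp (-(Q x)) * f x with hG
  have hG0 : ∀ x, 0 ≤ G x := fun x => mul_nonneg (Real.exp_pos _).le (hf0 x)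
  have hGm : Measurable G :=
    (Real.measurable_exp.comp hcont.measurable.neg).mul hfm
  have hFTC : ∀ b : ℝ, 0 ≤ b → ∫ x in (0 : ℝ)..b, G x = 1 - Real.exp (-(Q b)) := by
    intro b hb
    have hac : AbsolutelyContinuousOnInterval (fun x => -Real.exp (-(Q x))) 0 b := by
      refine LipschitzOnWith.absolutelyContinuousOnInterval (K := K) ?_
      refine LipschitzOnWith.of_dist_le_mul fun x hx y hy => ?_
      rw [uIcc_of_le hb] at hx hy
      have hx0 : 0 ≤ Q x := (mul_nonneg m.2 hx.1).trans (hQlb x hx.1)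
      have hy0 : 0 ≤ Q y := (mul_nonneg m.2 hy.1).trans (hQlb y hy.1)
      refine le_trans ?_ (hQlip.dist_le_mul x y)
      rw [Real.dist_eq, Real.dist_eq, abs_le]
      have e1 := Real.add_one_le_exp (-(Q x) + Q y)
      have e2 := Real.add_one_le_exp (-(Q y) + Q x)
      have e3 : Real.exp (-(Q x)) = Real.exp (-(Q x) + Q y) * Real.exp (-(Q y)) := by
        rw [← Real.exp_add]; ring_nf
      have e4 : Real.exp (-(Q y)) = Real.exp (-(Q y) + Q x) * Real.exp (-(Q x)) := by
        rw [← Real.exp_add]; ring_nf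
      have e5 : Real.exp (-(Q x)) ≤ 1 := Real.exp_le_one_iff.2 (by linarith)
      have e6 : Real.exp (-(Q y)) ≤ 1 := Real.exp_le_one_iff.2 (by linarith)
      have p1 := Real.exp_pos (-(Q x))
      have p2 := Real.exp_pos (-(Q y))
      rcases le_total (Q x) (Q y) with h | h
      · rw [abs_of_nonpos (by linarith)]
        have := Real.exp_le_exp.2 (neg_le_neg h)
        constructor <;> nlinarith
      · rw [abs_of_nonneg (by linarith)]
        have := Real.exp_le_exp.2 (neg_le_neg h)
        constructor <;> nlinarith
    have h1 := hac.integral_deriv_eq_sub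
    have h2 : ∫ x in (0 : ℝ)..b, deriv (fun x => -Real.exp (-(Q x))) x
        = ∫ x in (0 : ℝ)..b, G x := by
      refine intervalIntegral.integral_congr_ae ?_
      filter_upwards [hQder] with x hx _
      have := (hx.neg.exp.neg).deriv
      simp only [Pi.neg_apply] at this
      rw [hG]
      simp only
      refine Eq.trans ?_ (this.trans (by ring))
      rfl
    rw [← h2, h1]
    have : Q 0 = 0 := by simp [hQ]
    simp [this]; ring
  have hlim : Tendsto (fun n : ℕ => ∫ x in (0 : ℝ)..n, G x) atTop (𝓝 1) := by
    have hQt : Tendsto (fun n : ℕ => Q n) atTop atTop := by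
      refine tendsto_atTop_mono (fun n : ℕ => hQlb n n.cast_nonneg) ?_
      exact tendsto_natCast_atTop_atTop.const_mul_atTop (by exact_mod_cast hm)
    have h1 : Tendsto (fun n : ℕ => 1 - Real.exp (-(Q n))) atTop (𝓝 (1 - 0)) :=
      tendsto_const_nhds.sub (Real.tendsto_exp_neg_atTop_nhds_zero.comp hQt)
    rw [sub_zero] at h1
    exact h1.congr fun n => (hFTC n n.cast_nonneg).symm
  have hGi : ∀ b : ℝ, IntegrableOn G (Ioc 0 b) := by
    intro b
    refine Measure.integrableOn_of_bounded (M := K) (by simp) hGm.aestronglyMeasurable ?_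
    refine (ae_restrict_mem measurableSet_Ioc).mono fun x hx => ?_
    have hx0 : 0 ≤ Q x := (mul_nonneg m.2 hx.1.le).trans (hQlb x hx.1.le)
    have e5 : Real.exp (-(Q x)) ≤ 1 := Real.exp_le_one_iff.2 (by linarith)
    rw [Real.norm_of_nonneg (hG0 x)]
    calc G x ≤ 1 * f x := mul_le_mul_of_nonneg_right e5 (hf0 x)
      _ ≤ K := by rw [one_mul]; exact hfK x
  have hGI : IntegrableOn G (Ioi 0) := by
    refine integrableOn_Ioi_of_intervalIntegral_norm_tendsto 1 0 (b := fun n : ℕ => (n : ℝ))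
      (l := atTop) (fun n => hGi n) tendsto_natCast_atTop_atTop ?_
    refine hlim.congr fun n => ?_
    exact intervalIntegral.integral_congr fun x _ => (Real.norm_of_nonneg (hG0 x)).symm
  have hGval : ∫ x in Ioi (0 : ℝ), G x = 1 :=
    tendsto_nhds_unique
      (intervalIntegral_tendsto_integral_Ioi 0 hGI tendsto_natCast_atTop_atTop) hlim
  rw [lintegral_leb]
  have : ∫⁻ x in Ioi (0 : ℝ), ENNReal.ofReal (G x) = 1 := by
    rw [← ofReal_integral_eq_lintegral_ofReal hGI (Eventually.of_forall hG0), hGval]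
    simp
  rw [← this]
  refine setLIntegral_congr_fun measurableSet_Ioi fun x hx => ?_
  rw [hQeq x (le_of_lt hx), hG]
  simp only
  rw [ENNReal.ofReal_mul (Real.exp_pos _).le, hf, ENNReal.ofReal_toReal (hqtop _)]

/-- The total jump rate `-λ_ii(y, v) = ∑_{j ≠ i} λ_ij(y, v)` (possibly infinite). -/
def exitRate {S U : Type*} (rate : S → S → ℝ≥0 → U → ℝ≥0) (i : S) (y : ℝ≥0) (v : U) : ℝ≥0∞ :=
  ∑' j : {j : S // j ≠ i}, (rate i j y v : ℝ≥0∞)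

/-- Data of the control problem: measurable transition rates `λ_ij(y, v)` for `j ≠ i` (diagonal
values are never used) and a nonnegative running cost `c(i, y, v)`. The total jump rates
are bounded and bounded away from zero. -/
structure Model (S U : Type*) [MeasurableSpace U] where
  rate : S → S → ℝ≥0 → U → ℝ≥0
  cost : S → ℝ≥0 → U → ℝ≥0
  measurable_rate : ∀ i j, j ≠ i → Measurable fun p : ℝ≥0 × U => rate i j p.1 p.2
  bounded : ∃ K : ℝ≥0, (⨆ i, ⨆ y, ⨆ v, exitRate rate i y v) < K
  bounded_below : ∃ m : ℝ≥0, 0 < m ∧ (m : ℝ≥0∞) < ⨅ i, ⨅ y, ⨅ v, exitRate rate i y v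

/-- The set `𝓡` of measurable maps `r : [0, ∞) → 𝓟(U)`, that is, of Markov kernels. -/
abbrev Action (U : Type*) [MeasurableSpace U] : Type _ :=
  {r : Kernel ℝ≥0 U // IsMarkovKernel r}

/-- The set `𝓤` of admissible (stationary Markov relaxed) controls: measurable maps
`u : S × [0, ∞) → 𝓟(U)`, that is, Markov kernels. -/
abbrev Control (S U : Type*) [MeasurableSpace S] [MeasurableSpace U] : Type _ :=
  {u : Kernel (S × ℝ≥0) U // IsMarkovKernel u}

/-- The action `y ↦ u(i, y)` that a control uses in the state `i`. -/
def Control.action {S U : Type*} [MeasurableSpace S] [MeasurableSpace U]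
    (u : Control S U) (i : S) : Action U :=
  ⟨u.1.comap (fun y => (i, y)) measurable_prodMk_left, by
    have := u.2
    infer_instance⟩

/-- The control `u(i, y) = r_i(y)`. -/
def Control.ofActions {S U : Type*} [Countable S] [MeasurableSpace S] [DiscreteMeasurableSpace S]
    [MeasurableSpace U] (r : S → Action U) : Control S U :=
  ⟨{  toFun := fun p => (r p.1).1 p.2
      measurable' := measurable_from_prod_countable_right fun i => (r i).1.measurable },
    ⟨fun p => (r p.1).2.isProbabilityMeasure p.2⟩⟩

namespace Model

section Stage

variable {S U : Type*} [MeasurableSpace U] (M : Model S U)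

/-- The relaxed rate `∫ λ_ij(y, v) r_y(dv)`. -/
def meanRate (i j : S) (r : Action U) (y : ℝ≥0) : ℝ≥0∞ :=
  ∫⁻ v, (M.rate i j y v : ℝ≥0∞) ∂(r.1 y)

/-- The relaxed total rate `∫ ∑_{k ≠ i} λ_ik(y, v) r_y(dv)`. -/
def meanExitRate (i : S) (r : Action U) (y : ℝ≥0) : ℝ≥0∞ :=
  ∫⁻ v, exitRate M.rate i y v ∂(r.1 y)

/-- The relaxed cost rate `∫ c(i, y, v) r_y(dv)`. -/
def meanCost (i : S) (r : Action U) (y : ℝ≥0) : ℝ≥0∞ :=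
  ∫⁻ v, (M.cost i y v : ℝ≥0∞) ∂(r.1 y)

/-- `exp(-∫_0^t ∫ ∑_{k ≠ i} λ_ik(s, v) r_s(dv) ds)`, the probability of no jump up to age `t`. -/
def survival (i : S) (r : Action U) (t : ℝ≥0) : ℝ≥0∞ :=
  ENNReal.ofReal (Real.exp (-(∫⁻ s in Iio t, M.meanExitRate i r s ∂leb).toReal))

/-- `φ(i, r)`, the expected cost up to the next jump. -/
def stageCost (i : S) (r : Action U) : ℝ≥0∞ :=
  ∫⁻ y, M.survival i r y * M.meanCost i r y ∂leb

/-- `p̂_ij(r)`, the transition probabilities of the embedded chain. -/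
def transProb (i j : S) (r : Action U) : ℝ≥0∞ :=
  ∫⁻ y, M.survival i r y * M.meanRate i j r y ∂leb

/-- `τ̄(i, r)`, the expected sojourn time. -/
def meanSojourn (i : S) (r : Action U) : ℝ≥0∞ :=
  ∫⁻ t, M.survival i r t ∂leb

/-- `φ(i, r) + ∑_{j ≠ i} p̂_ij(r) ψ(j) - ρ τ̄(i, r)`. -/
def bracket (ψ : S → ℝ) (ρ : ℝ) (i : S) (r : Action U) : ℝ :=
  (M.stageCost i r).toReal + (∑' j : {j : S // j ≠ i}, (M.transProb i j r).toReal * ψ j)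
    - ρ * (M.meanSojourn i r).toReal

/-- `(ψ, ρ)` solves the average cost equation `ψ(i) = inf_r bracket(i, r)`. -/
def IsSolution (ψ : S → ℝ) (ρ : ℝ) : Prop :=
  ∀ i, IsGLB (range (M.bracket ψ ρ i)) (ψ i)

/-- `r` attains `inf_{r' ∈ 𝓡} bracket(i, r')`. -/
def IsMinimizer (ψ : S → ℝ) (ρ : ℝ) (i : S) (r : Action U) : Prop :=
  ∀ r', M.bracket ψ ρ i r ≤ M.bracket ψ ρ i r'

/-- The rates `λ_ij`, `j ≠ i`, are jointly continuous, and `∑_{j ≠ i} λ_ij(y, v)` converges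
uniformly in `(y, v)` for each `i`. -/
def ContinuousRates [TopologicalSpace U] : Prop :=
  (∀ i j, j ≠ i → Continuous fun p : ℝ≥0 × U => M.rate i j p.1 p.2) ∧
  ∀ i, TendstoUniformly
    (fun (F : Finset {j : S // j ≠ i}) (p : ℝ≥0 × U) => ∑ j ∈ F, M.rate i j p.1 p.2)
    (fun p => ∑' j : {j : S // j ≠ i}, M.rate i j p.1 p.2) atTop

/-- The cost is continuous in the age and in the control variable, and bounded. -/
def ContinuousBoundedCost [TopologicalSpace U] : Prop :=
  (∀ i v, Continuous fun y => M.cost i y v) ∧ (∀ i y, Continuous (M.cost i y)) ∧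
  ∃ C : ℝ≥0, ∀ i y v, M.cost i y v ≤ C

/-- The law of (next state, sojourn time) after a jump to `i` when `r` is used there:
at age `t` the process jumps to `j` with rate `∫ λ_ij(t, v) r_t(dv)`. -/
def jumpLaw [MeasurableSpace S] (i : S) (r : Action U) : Measure (S × ℝ≥0) :=
  Measure.sum fun j : {j : S // j ≠ i} =>
    (leb.withDensity fun t => M.survival i r t * M.meanRate i j r t).map fun t => (j.1, t)

end Stage

section Dynamics

variable {S U : Type*} [Countable S] [MeasurableSpace S] [DiscreteMeasurableSpace S]
  [MeasurableSpace U] (M : Model S U)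

theorem isProbabilityMeasure_jumpLaw (i : S) (r : Action U) :
    IsProbabilityMeasure (M.jumpLaw i r) := by
  have := r.2
  obtain ⟨K, hK⟩ := M.bounded
  obtain ⟨m, hm, hmq⟩ := M.bounded_below
  have hlo : ∀ y v, (m : ℝ≥0∞) ≤ exitRate M.rate i y v := fun y v =>
    hmq.le.trans ((iInf_le _ i).trans ((iInf_le _ y).trans (iInf_le _ v)))
  have hup : ∀ y v, exitRate M.rate i y v ≤ K := fun y v =>
    ((le_iSup (fun v => exitRate M.rate i y v) v).trans
      ((le_iSup (fun y => ⨆ v, exitRate M.rate i y v) y).trans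
        (le_iSup (fun i => ⨆ y, ⨆ v, exitRate M.rate i y v) i))).trans hK.le
  have hmr : ∀ j : {j : S // j ≠ i},
      Measurable fun p : ℝ≥0 × U => (M.rate i j p.1 p.2 : ℝ≥0∞) := fun j =>
    (M.measurable_rate i j j.2).coe_nnreal_ennreal
  have hmean : ∀ j : {j : S // j ≠ i}, Measurable (M.meanRate i j r) := fun j =>
    Measurable.lintegral_kernel_prod_right (κ := r.1)
      (f := fun y v => (M.rate i j y v : ℝ≥0∞)) (hmr j)
  have hsum : ∀ y, M.meanExitRate i r y = ∑' j : {j : S // j ≠ i}, M.meanRate i j r y := by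
    intro y
    refine lintegral_tsum fun j => ?_
    exact ((hmr j).comp measurable_prodMk_left).aemeasurable
  have hexit : Measurable (M.meanExitRate i r) := by
    have : M.meanExitRate i r = fun y => ∑' j : {j : S // j ≠ i}, M.meanRate i j r y :=
      funext hsum
    rw [this]
    exact Measurable.tsum hmean
  have hq1 : ∀ y, (m : ℝ≥0∞) ≤ M.meanExitRate i r y := fun y => by
    have := lintegral_mono (μ := r.1 y) (fun v => hlo y v)
    simpa [meanExitRate] using this
  have hq2 : ∀ y, M.meanExitRate i r y ≤ K := fun y => by
    have := lintegral_mono (μ := r.1 y) (fun v => hup y v)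
    simpa [meanExitRate] using this
  have hsurv : Measurable (M.survival i r) := by
    refine (Antitone.measurable ?_)
    intro a b hab
    refine ENNReal.ofReal_le_ofReal (Real.exp_le_exp.2 (neg_le_neg ?_))
    refine ENNReal.toReal_mono ?_ (lintegral_mono_set (Iio_subset_Iio hab))
    refine ((lintegral_mono hq2).trans_lt ?_).ne
    rw [lintegral_const, Measure.restrict_apply_univ]
    refine ENNReal.mul_lt_top ENNReal.coe_lt_top ?_
    have hle : leb (Iio b) ≤ volume (Ico (0 : ℝ) b) := by
      rw [leb, (NNReal.isEmbedding_coe.measurableEmbedding (by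
        rw [NNReal.range_coe]; exact measurableSet_Ici)).comap_apply]
      refine measure_mono ?_
      rintro _ ⟨x, hx, rfl⟩
      exact ⟨x.2, by exact_mod_cast hx⟩
    exact hle.trans_lt (by simp)
  constructor
  rw [jumpLaw, Measure.sum_apply _ MeasurableSet.univ]
  have h1 : ∀ j : {j : S // j ≠ i},
      ((leb.withDensity fun t => M.survival i r t * M.meanRate i j r t).map
        fun t => (j.1, t)) univ = ∫⁻ t, M.survival i r t * M.meanRate i j r t ∂leb := by
    intro j
    rw [Measure.map_apply measurable_prodMk_left MeasurableSet.univ, preimage_univ,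
      withDensity_apply _ MeasurableSet.univ, Measure.restrict_univ]
  simp only [h1]
  rw [← lintegral_tsum (f := fun (j : {j : S // j ≠ i}) t => M.survival i r t * M.meanRate i j r t)
    fun j => (hsurv.mul (hmean j)).aemeasurable]
  simp only [ENNReal.tsum_mul_left, ← hsum]
  exact lintegral_hazard hexit hm hq1 hq2

/-- From the state entered at the last jump to (next state, sojourn time), under `u`. -/
def jumpKernel (u : Control S U) : Kernel S (S × ℝ≥0) :=
  Kernel.ofFunOfCountable fun i => M.jumpLaw i (u.action i)

instance (u : Control S U) : IsMarkovKernel (M.jumpKernel u) :=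
  ⟨fun i => M.isProbabilityMeasure_jumpLaw i (u.action i)⟩

/-- The law `P^u_{i,0}` of the controlled process started at `(X_0, Y_0) = (i, 0)`, on the space
of sequences `ω` whose `n`-th entry is `(X_{T_n}, T_n - T_{n-1})`, for the jump times
`0 = T_0 < T_1 < ...`; the entry `0` is `(i, 0)`. -/
def law (u : Control S U) (i : S) : Measure (ℕ → S × ℝ≥0) :=
  Kernel.trajMeasure (X := fun _ => S × ℝ≥0) (Measure.dirac (i, 0)) fun n =>
    (M.jumpKernel u).comap (fun x => (x ⟨n, Finset.mem_Iic.2 le_rfl⟩).1) (by fun_prop)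

end Dynamics

end Model

section Path

variable {S : Type*}

/-- The `n`-th jump time `T_n`. -/
def jumpTime (ω : ℕ → S × ℝ≥0) (n : ℕ) : ℝ≥0 := ∑ k ∈ Finset.range n, (ω (k + 1)).2

/-- The number of jumps up to time `t`. -/
def jumpCount (ω : ℕ → S × ℝ≥0) (t : ℝ≥0) : ℕ := sSup {n | jumpTime ω n ≤ t}

/-- The state `X_t`. -/
def stateAt (ω : ℕ → S × ℝ≥0) (t : ℝ≥0) : S := (ω (jumpCount ω t)).1

/-- The age `Y_t`, the time since the last jump. -/
def ageAt (ω : ℕ → S × ℝ≥0) (t : ℝ≥0) : ℝ≥0 := t - jumpTime ω (jumpCount ω t)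

end Path

namespace Model

variable {S U : Type*} [Countable S] [MeasurableSpace S] [DiscreteMeasurableSpace S]
  [MeasurableSpace U] (M : Model S U)

/-- `E^u_{i,0} ∫_0^{T_n} ∫ c(X_t, Y_t, v) u(X_t, Y_t)(dv) dt`. -/
def expectedCost (u : Control S U) (i : S) (n : ℕ) : ℝ≥0∞ :=
  ∫⁻ ω, ∫⁻ t in Iio (jumpTime ω n),
    (∫⁻ v, (M.cost (stateAt ω t) (ageAt ω t) v : ℝ≥0∞) ∂(u.1 (stateAt ω t, ageAt ω t))) ∂leb
    ∂(M.law u i)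

/-- `E^u_{i,0} T_n`. -/
def expectedTime (u : Control S U) (i : S) (n : ℕ) : ℝ≥0∞ :=
  ∫⁻ ω, (jumpTime ω n : ℝ≥0∞) ∂(M.law u i)

/-- The long-run average cost `J^u(i)`. -/
def averageCost (u : Control S U) (i : S) : ℝ≥0∞ :=
  limsup (fun n => M.expectedCost u i n / M.expectedTime u i n) atTop

/-- The optimal average cost `inf_u J^u(i)`. -/
def optimalCost (i : S) : ℝ≥0∞ := ⨅ u : Control S U, M.averageCost u i

/-- The control `u` is average optimal. -/
def IsAverageOptimal (u : Control S U) : Prop := ∀ i, M.averageCost u i = M.optimalCost i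

end Model

end

end AgeControl

/-!
Two ingredients give the theorem.

**Verification.** Let `X_k` be the state entered at the `k`-th jump. Each cycle between two jumps is
a renewal stage: its expected cost and length given `X_k` are `φ(X_k, u)` and `τ̄(X_k, u)`. The cost
part is Tonelli's theorem together with `P(τ > s) = Σ(s)`
(`Model.lintegral_jumpLaw_setLIntegral_Iio`). Summing the brackets of the average cost equation
along the chain telescopes the values of `h` (`Model.exists_expectations`):
`E cost_n - g E T_n + E h(X_n) - h(X_0)` is a sum of `n` terms `bracket - h`, each nonnegative by
the equation, and zero if the control uses minimizers. As `h` is bounded and `E T_n` grows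
linearly, division by `E T_n` gives `J ≥ g` for every control (`Model.averageCost_ge`) and `J = g`
for a control made of minimizers (`Model.averageCost_eq`).

**Minimizers.** For a fixed state the bracket is a control problem on the half line with running
cost `ℓ(y, v)` (`Model.stageRate`) and discount rate `q(y, v) = ∑_{j ≠ i} λ_ij(y, v)`. Instead of
compactness of the space of relaxed controls, the proof uses dynamic programming. The equation
`W' = -min_v (ℓ - q W)` is rewritten, with a constant `K` above the discount rates, as
`W(y) = ∫_y^∞ exp(-K (s - y)) G(s, W(s)) ds` with `G(s, w) = min_v (ℓ + (K - q) w)`. As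
`m ≤ q ≤ K`, the function `G` is `(K - m)`-Lipschitz in `w`, so the right-hand side is a
contraction with constant `(K - m) / K` on bounded continuous functions
(`exists_eq_discountedTail`). With
`k(y) = min_v (ℓ - q W)`, the fundamental theorem of calculus for absolutely continuous functions
(`integral_exp_neg_primitive_mul`) gives `∫ Σ (q W + k) = W(0)` along every action, hence
`bracket - W(0) = ∫ Σ (ℓ - q W - k) ≥ 0`, with equality for the Dirac action at a measurable
pointwise minimizer, which exists by `exists_measurable_argmin`.
-/

namespace AgeControl

/-! ### Measurable selection of minimizers -/

/-- For a Carathéodory function on a compact space, the parameters whose set of minimizers meets the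
closed set `D` form a measurable set: the infimum over `D` and the infimum over the whole space are
both infima over countable dense sequences. -/
theorem measurableSet_exists_forall_le {Y X : Type*} [MeasurableSpace Y] [MetricSpace X]
    [CompactSpace X] (f : Y → X → ℝ) (hc : ∀ y, Continuous (f y))
    (hm : ∀ x, Measurable fun y => f y x) {D : Set X} (hD : IsClosed D) :
    MeasurableSet {y | ∃ x ∈ D, ∀ x', f y x ≤ f y x'} := by
  rcases D.eq_empty_or_nonempty with rfl | hne
  · simp
  have : Nonempty D := hne.to_subtype
  have : Nonempty X := ⟨hne.some⟩
  have key : {y | ∃ x ∈ D, ∀ x', f y x ≤ f y x'}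
      = ⋂ (k : ℕ) (n : ℕ), ⋃ j : ℕ, {y | f y (TopologicalSpace.denseSeq D j)
          < f y (TopologicalSpace.denseSeq X n) + 1 / ((k : ℝ) + 1)} := by
    ext y
    simp only [mem_ofPred_eq, mem_iInter, mem_iUnion]
    constructor
    · rintro ⟨x, hx, hmin⟩ k n
      have ho : IsOpen {z : D | f y z < f y (TopologicalSpace.denseSeq X n) + 1 / ((k : ℝ) + 1)} :=
        isOpen_lt ((hc y).comp continuous_subtype_val) continuous_const
      exact (TopologicalSpace.denseRange_denseSeq D).exists_mem_open ho
        ⟨⟨x, hx⟩, lt_of_le_of_lt (hmin _) (lt_add_of_pos_right _ Nat.one_div_pos_of_nat)⟩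
    · intro h
      obtain ⟨x, hx, hmin⟩ := hD.isCompact.exists_isMinOn hne (hc y).continuousOn
      refine ⟨x, hx, fun x' => ?_⟩
      refine (TopologicalSpace.denseRange_denseSeq X).induction_on x'
        (isClosed_le continuous_const (hc y)) fun n => ?_
      refine le_of_forall_pos_lt_add fun ε hε => ?_
      obtain ⟨k, hk⟩ := exists_nat_one_div_lt hε
      obtain ⟨j, hj⟩ := h k n
      have := hmin (TopologicalSpace.denseSeq D j).2
      simp only [mem_ofPred_eq] at this
      linarith
  rw [key]
  exact MeasurableSet.iInter fun k => MeasurableSet.iInter fun n => MeasurableSet.iUnion fun j =>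
    measurableSet_lt (hm _) ((hm _).add_const _)

/-- Measurable selection of a minimizer. The compact space is a continuous image of the Cantor set,
and the selector is the image of the least code, as a real number, of a minimizer. -/
theorem exists_measurable_argmin {Y U : Type*} [MeasurableSpace Y] [MetricSpace U] [CompactSpace U]
    [Nonempty U] [MeasurableSpace U] [BorelSpace U] (f : Y → U → ℝ)
    (hc : ∀ y, Continuous (f y)) (hm : ∀ v, Measurable fun y => f y v) :
    ∃ s : Y → U, Measurable s ∧ ∀ y v, f y (s y) ≤ f y v := by
  obtain ⟨p, hpc, hps⟩ := exists_nat_bool_continuous_surjective_of_compact U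
  let π : cantorSet → U := fun x => p (cantorSetHomeomorphNatToBool x)
  have hπc : Continuous π := hpc.comp cantorSetHomeomorphNatToBool.continuous
  have hπs : Function.Surjective π := hps.comp cantorSetHomeomorphNatToBool.surjective
  have hC : CompactSpace cantorSet := isCompact_iff_compactSpace.1 isCompact_cantorSet
  have hne : Nonempty cantorSet := ⟨⟨0, zero_mem_cantorSet⟩⟩
  let A : Y → Set cantorSet := fun y => {x | ∀ x', f y (π x) ≤ f y (π x')}
  have hAne : ∀ y, (A y).Nonempty := fun y => by
    obtain ⟨x, -, hx⟩ := isCompact_univ.exists_isMinOn (univ_nonempty (α := cantorSet))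
      ((hc y).comp hπc).continuousOn
    exact ⟨x, fun x' => hx (mem_univ x')⟩
  have hAcl : ∀ y, IsClosed (A y) := fun y => by
    simp only [A, Set.ofPred_forall]
    exact isClosed_iInter fun x' => isClosed_le ((hc y).comp hπc) continuous_const
  have hleast : ∀ y, ∃ x ∈ A y, ∀ x' ∈ A y, x ≤ x' := fun y => by
    obtain ⟨x, hx, hx'⟩ := (hAcl y).isCompact.exists_isLeast (hAne y)
    exact ⟨x, hx, fun x' h => hx' h⟩
  choose t htA htl using hleast
  have htm : Measurable t := by
    refine (MeasurableEmbedding.subtype_coe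
      isClosed_cantorSet.measurableSet).measurable_comp_iff.1 (measurable_of_Iic fun a => ?_)
    convert! measurableSet_exists_forall_le (fun y x => f y (π x)) (fun y => (hc y).comp hπc)
      (fun x => hm _) (D := {x : cantorSet | (x : ℝ) ≤ a})
      (isClosed_le continuous_subtype_val continuous_const) using 1
    ext y
    exact ⟨fun h => ⟨t y, h, htA y⟩, fun ⟨x, hx, hmin⟩ =>
      show (t y : ℝ) ≤ a from le_trans (htl y x hmin) hx⟩
  exact ⟨fun y => π (t y), hπc.measurable.comp htm, fun y v => by
    obtain ⟨x, rfl⟩ := hπs v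
    exact htA y x⟩

/-! ### Discounting with a variable rate -/

theorem intervalIntegrable_of_bounded {f : ℝ → ℝ} (hf : Measurable f) {C : ℝ}
    (hC : ∀ x, |f x| ≤ C) (a b : ℝ) : IntervalIntegrable f volume a b := by
  rw [intervalIntegrable_iff]
  exact Measure.integrableOn_of_bounded (M := C) (by simp) hf.aestronglyMeasurable
    (Eventually.of_forall hC)

theorem locallyIntegrable_of_bounded {f : ℝ → ℝ} (hf : Measurable f) {C : ℝ}
    (hC : ∀ x, |f x| ≤ C) : LocallyIntegrable f volume :=
  (locallyIntegrable_const (C : ℝ)).mono hf.aestronglyMeasurable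
    (Eventually.of_forall fun x => (hC x).trans (le_abs_self _))

theorem lipschitzOnWith_exp_Iic : LipschitzOnWith 1 Real.exp (Iic 0) := by
  refine Convex.lipschitzOnWith_of_nnnorm_deriv_le (fun x _ => Real.differentiableAt_exp)
    (fun x hx => ?_) (convex_Iic 0)
  rw [Real.deriv_exp, ← NNReal.coe_le_coe]
  simpa using hx

theorem mul_le_primitive {f : ℝ → ℝ} (hf : Measurable f) {m K : ℝ}
    (hm : ∀ x, m ≤ f x) (hK : ∀ x, |f x| ≤ K) {x : ℝ} (hx : 0 ≤ x) :
    m * x ≤ ∫ s in (0 : ℝ)..x, f s := by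
  have := intervalIntegral.integral_mono_on hx (intervalIntegrable_const (c := m))
    (intervalIntegrable_of_bounded hf hK 0 x) (fun s _ => hm s)
  simp only [intervalIntegral.integral_const, smul_eq_mul, sub_zero] at this
  rwa [mul_comm]

theorem absolutelyContinuousOnInterval_exp_neg_primitive {f : ℝ → ℝ} (hf : Measurable f) {K : ℝ}
    (h0 : ∀ x, 0 ≤ f x) (hK : ∀ x, |f x| ≤ K) {b : ℝ} (hb : 0 ≤ b) :
    AbsolutelyContinuousOnInterval (fun x => Real.exp (-∫ s in (0 : ℝ)..x, f s)) 0 b := by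
  have hint := intervalIntegrable_of_bounded hf hK
  have hlip : LipschitzWith K.toNNReal fun x => -∫ s in (0 : ℝ)..x, f s := by
    refine LipschitzWith.of_dist_le_mul fun x y => ?_
    rw [Real.dist_eq, Real.dist_eq, neg_sub_neg, intervalIntegral.integral_interval_sub_left
      (hint _ _) (hint _ _), Real.coe_toNNReal _ ((abs_nonneg _).trans (hK 0)), abs_sub_comm]
    exact intervalIntegral.norm_integral_le_of_norm_le_const
      (f := f) (C := K) (fun s _ => hK s)
  refine LipschitzOnWith.absolutelyContinuousOnInterval (K := 1 * K.toNNReal) ?_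
  refine lipschitzOnWith_exp_Iic.comp hlip.lipschitzOnWith fun x hx => ?_
  rw [uIcc_of_le hb] at hx
  have := mul_le_primitive hf h0 hK hx.1
  simpa using this

theorem integrableOn_exp_neg_primitive_mul {f : ℝ → ℝ} (hf : Measurable f) {m K : ℝ}
    (hm0 : 0 < m) (hm : ∀ x, m ≤ f x) (hK : ∀ x, |f x| ≤ K) {k : ℝ → ℝ} (hk : Measurable k)
    {C : ℝ} (hC : ∀ x, |k x| ≤ C) :
    IntegrableOn (fun x => Real.exp (-∫ s in (0 : ℝ)..x, f s) * k x) (Ioi 0) := by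
  have hc : Continuous fun x => ∫ s in (0 : ℝ)..x, f s :=
    intervalIntegral.continuous_primitive (intervalIntegrable_of_bounded hf hK) 0
  refine Integrable.mono' ((integrableOn_exp_mul_Ioi (neg_lt_zero.2 hm0) 0).mul_const C)
    ((Real.continuous_exp.comp hc.neg).measurable.mul hk).aestronglyMeasurable ?_
  refine (ae_restrict_mem measurableSet_Ioi).mono fun x hx => ?_
  rw [norm_mul, Real.norm_of_nonneg (Real.exp_pos _).le, Real.norm_eq_abs]
  have := mul_le_primitive hf hm hK (le_of_lt hx)
  gcongr
  · linarith
  · exact hC x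

/-- If `W' = -k` almost everywhere, then `exp(-∫_0^x f) (f W + k)` is minus the derivative of
`exp(-∫_0^x f) W`, which vanishes at infinity because `f ≥ m > 0`. -/
theorem integral_exp_neg_primitive_mul {f : ℝ → ℝ} (hf : Measurable f) {m K : ℝ}
    (hm0 : 0 < m) (hm : ∀ x, m ≤ f x) (hK : ∀ x, |f x| ≤ K) {W k : ℝ → ℝ} (hk : Measurable k)
    {C B : ℝ} (hC : ∀ x, |k x| ≤ C) (hWB : ∀ x, |W x| ≤ B) (hWc : Continuous W)
    (hWac : ∀ b, 0 ≤ b → AbsolutelyContinuousOnInterval W 0 b)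
    (hW : ∀ᵐ x, HasDerivAt W (-k x) x) :
    ∫ x in Ioi (0 : ℝ), Real.exp (-∫ s in (0 : ℝ)..x, f s) * (f x * W x + k x) = W 0 := by
  have hbd : ∀ x, |f x * W x + k x| ≤ K * B + C := fun x => by
    refine (abs_add_le _ _).trans (add_le_add ?_ (hC x))
    rw [abs_mul]
    exact mul_le_mul (hK x) (hWB x) (abs_nonneg _) ((abs_nonneg _).trans (hK x))
  have hI := integrableOn_exp_neg_primitive_mul hf hm0 hm hK ((hf.mul hWc.measurable).add hk) hbd
  set E : ℝ → ℝ := fun x => Real.exp (-∫ s in (0 : ℝ)..x, f s) with hE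
  have hder : ∀ᵐ x, HasDerivAt (fun x => ∫ s in (0 : ℝ)..x, f s) (f x) x :=
    (_root_.LocallyIntegrable.ae_hasDerivAt_integral (locallyIntegrable_of_bounded hf hK)).mono
      fun x hx => hx 0
  have hFTC : ∀ b : ℝ, 0 ≤ b → ∫ x in (0 : ℝ)..b, E x * (f x * W x + k x) = W 0 - E b * W b := by
    intro b hb
    have hac := (absolutelyContinuousOnInterval_exp_neg_primitive hf
      (fun x => hm0.le.trans (hm x)) hK hb).fun_mul (hWac b hb)
    have h1 := hac.integral_deriv_eq_sub
    simp only [intervalIntegral.integral_same, neg_zero, Real.exp_zero, one_mul] at h1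
    rw [← neg_sub, ← h1, ← intervalIntegral.integral_neg]
    refine intervalIntegral.integral_congr_ae ?_
    filter_upwards [hder, hW] with x hx hx' _
    have : deriv (fun x => Real.exp (-∫ s in (0 : ℝ)..x, f s) * W x) x = _ :=
      (hx.fun_neg.exp.fun_mul hx').deriv
    rw [this, hE]
    ring
  refine tendsto_nhds_unique
    (intervalIntegral_tendsto_integral_Ioi 0 hI tendsto_natCast_atTop_atTop)
    (Tendsto.congr (fun n : ℕ => (hFTC n n.cast_nonneg).symm) ?_)
  suffices h : Tendsto (fun n : ℕ => E n * W n) atTop (𝓝 0) by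
    simpa using (tendsto_const_nhds (x := W 0)).sub h
  have hlim : Tendsto (fun n : ℕ => Real.exp (-(m * n)) * B) atTop (𝓝 (0 * B)) :=
    (Real.tendsto_exp_neg_atTop_nhds_zero.comp
      (tendsto_natCast_atTop_atTop.const_mul_atTop hm0)).mul_const B
  rw [zero_mul] at hlim
  refine squeeze_zero_norm (fun n => ?_) hlim
  rw [norm_mul, Real.norm_of_nonneg (Real.exp_pos _).le, Real.norm_eq_abs]
  have := mul_le_primitive hf hm hK (n.cast_nonneg (α := ℝ))
  gcongr
  exact hWB _

/-! ### Discounted tails and the Bellman fixed point -/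

section BoundedFunctions

open scoped BoundedContinuousFunction

/-- The tail integral `∫_y^∞ exp(-K (s - y)) f(s) ds`, the value at `y` of the running cost `f`
discounted at the constant rate `K`. -/
noncomputable def discountedTail (K : ℝ) (f : ℝ → ℝ) (y : ℝ) : ℝ :=
  Real.exp (K * y) * ∫ s in Ioi y, Real.exp (-K * s) * f s

section discountedTail

variable {K : ℝ} {f : ℝ → ℝ} {D : ℝ}

theorem integrableOn_exp_mul_bounded (hK : 0 < K) (hf : Measurable f) (hD : ∀ x, |f x| ≤ D)
    (y : ℝ) : IntegrableOn (fun s => Real.exp (-K * s) * f s) (Ioi y) := by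
  refine Integrable.mono' ((integrableOn_exp_mul_Ioi (neg_lt_zero.2 hK) y).mul_const D)
    (by fun_prop) (Eventually.of_forall fun x => ?_)
  rw [norm_mul, Real.norm_of_nonneg (Real.exp_pos _).le]
  exact mul_le_mul_of_nonneg_left (hD x) (Real.exp_pos _).le

theorem abs_discountedTail_le (hK : 0 < K) (hD : ∀ x, |f x| ≤ D) (y : ℝ) :
    |discountedTail K f y| ≤ D / K := by
  have h : ‖∫ s in Ioi y, Real.exp (-K * s) * f s‖ ≤ ∫ s in Ioi y, Real.exp (-K * s) * D := by
    refine norm_integral_le_of_norm_le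
      ((integrableOn_exp_mul_Ioi (neg_lt_zero.2 hK) y).mul_const D)
      (Eventually.of_forall fun x => ?_)
    rw [norm_mul, Real.norm_of_nonneg (Real.exp_pos _).le]
    exact mul_le_mul_of_nonneg_left (hD x) (Real.exp_pos _).le
  rw [integral_mul_const, integral_exp_mul_Ioi (neg_lt_zero.2 hK)] at h
  rw [discountedTail, abs_mul, abs_of_pos (Real.exp_pos _)]
  refine (mul_le_mul_of_nonneg_left h (Real.exp_pos _).le).trans_eq ?_
  have : Real.exp (K * y) * Real.exp (-K * y) = 1 := by rw [← Real.exp_add]; simp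
  rw [neg_div_neg_eq]
  linear_combination D / K * this

theorem discountedTail_sub {f' : ℝ → ℝ} {D' : ℝ} (hK : 0 < K) (hf : Measurable f)
    (hD : ∀ x, |f x| ≤ D) (hf' : Measurable f') (hD' : ∀ x, |f' x| ≤ D') (y : ℝ) :
    discountedTail K f y - discountedTail K f' y = discountedTail K (fun x => f x - f' x) y := by
  simp only [discountedTail, mul_sub]
  rw [integral_sub (integrableOn_exp_mul_bounded hK hf hD y)
    (integrableOn_exp_mul_bounded hK hf' hD' y), mul_sub]

theorem discountedTail_eq (hK : 0 < K) (hf : Measurable f) (hD : ∀ x, |f x| ≤ D) :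
    discountedTail K f = fun y => Real.exp (K * y) * ((∫ s in Ioi 0, Real.exp (-K * s) * f s)
      - ∫ s in (0 : ℝ)..y, Real.exp (-K * s) * f s) := by
  funext y
  rw [discountedTail, ← intervalIntegral.integral_interval_add_Ioi
    (integrableOn_exp_mul_bounded hK hf hD 0) (integrableOn_exp_mul_bounded hK hf hD y),
    add_sub_cancel_left]

theorem locallyIntegrable_exp_mul_bounded (hf : Measurable f) (hD : ∀ x, |f x| ≤ D) :
    LocallyIntegrable (fun s => Real.exp (-K * s) * f s) := by
  have hc : Continuous fun s => Real.exp (-K * s) * D := by fun_prop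
  refine hc.locallyIntegrable.mono (by fun_prop) (Eventually.of_forall fun x => ?_)
  rw [norm_mul, norm_mul]
  exact mul_le_mul_of_nonneg_left ((hD x).trans (le_abs_self _)) (norm_nonneg _)

theorem intervalIntegrable_exp_mul_bounded (hf : Measurable f) (hD : ∀ x, |f x| ≤ D) (a b : ℝ) :
    IntervalIntegrable (fun s => Real.exp (-K * s) * f s) volume a b :=
  intervalIntegrable_iff.2 <| ((locallyIntegrable_exp_mul_bounded hf hD).integrableOn_isCompact
    isCompact_uIcc).mono_set uIoc_subset_uIcc

theorem continuous_discountedTail (hK : 0 < K) (hf : Measurable f) (hD : ∀ x, |f x| ≤ D) :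
    Continuous (discountedTail K f) := by
  rw [discountedTail_eq hK hf hD]
  have := intervalIntegral.continuous_primitive
    (intervalIntegrable_exp_mul_bounded (K := K) hf hD) 0
  fun_prop

theorem absolutelyContinuousOnInterval_discountedTail (hK : 0 < K) (hf : Measurable f)
    (hD : ∀ x, |f x| ≤ D) (a b : ℝ) :
    AbsolutelyContinuousOnInterval (discountedTail K f) a b := by
  rw [discountedTail_eq hK hf hD]
  have h1 : ContDiff ℝ 1 fun y => Real.exp (K * y) := by fun_prop
  have h2 := (intervalIntegrable_exp_mul_bounded (K := K) hf hD
    (min 0 (min a b)) (max 0 (max a b))).absolutelyContinuousOnInterval_intervalIntegral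
    (c := 0) (by
      rw [uIcc_of_le (by simp)]; simp)
  have h2 := h2.mono (c := a) (d := b) (by
    refine uIcc_subset_uIcc ?_ ?_ <;> rw [uIcc_of_le (by simp)] <;> simp)
  have h3 : AbsolutelyContinuousOnInterval
      (fun _ : ℝ => ∫ s in Ioi (0 : ℝ), Real.exp (-K * s) * f s) a b :=
    (contDiff_const (n := 1)).contDiffOn.absolutelyContinuousOnInterval
  exact h1.contDiffOn.absolutelyContinuousOnInterval.fun_mul (h3.fun_sub h2)

theorem ae_hasDerivAt_discountedTail (hK : 0 < K) (hf : Measurable f) (hD : ∀ x, |f x| ≤ D) :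
    ∀ᵐ x, HasDerivAt (discountedTail K f) (K * discountedTail K f x - f x) x := by
  filter_upwards [_root_.LocallyIntegrable.ae_hasDerivAt_integral
    (locallyIntegrable_exp_mul_bounded (K := K) hf hD)] with x hx
  rw [discountedTail_eq hK hf hD]
  have h1 : HasDerivAt (fun y => Real.exp (K * y)) (Real.exp (K * x) * (K * 1)) x :=
    ((hasDerivAt_id x).const_mul K).exp
  have h2 := h1.fun_mul ((hx 0).const_sub (∫ s in Ioi 0, Real.exp (-K * s) * f s))
  refine h2.congr_deriv ?_
  have : Real.exp (K * x) * Real.exp (-K * x) = 1 := by rw [← Real.exp_add]; simp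
  linear_combination (-f x) * this

end discountedTail

/-- Banach's fixed point theorem on bounded continuous functions: `W ↦ discountedTail K (G · (W ·))`
is a contraction with constant `L / K`. -/
theorem exists_eq_discountedTail {K L C : ℝ} (hL : 0 ≤ L) (hLK : L < K) (G : ℝ → ℝ → ℝ)
    (hG : ∀ w, Measurable fun s => G s w) (hlip : ∀ s w w', |G s w - G s w'| ≤ L * |w - w'|)
    (hC : ∀ s, |G s 0| ≤ C) :
    ∃ W : ℝ →ᵇ ℝ, (W : ℝ → ℝ) = discountedTail K fun s => G s (W s) := by
  have hK : 0 < K := hL.trans_lt hLK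
  have hcont : ∀ s, Continuous (G s) := fun s =>
    (LipschitzWith.of_dist_le_mul (K := L.toNNReal) fun w w' => by
      rw [Real.dist_eq, Real.dist_eq, Real.coe_toNNReal _ hL]; exact hlip s w w').continuous
  have hGW : ∀ W : ℝ →ᵇ ℝ, Measurable fun s => G s (W s) := fun W =>
    (measurable_uncurry_of_continuous_of_measurable (u := fun w s => G s w) hcont hG).comp
      (W.continuous.measurable.prodMk measurable_id)
  have hbd : ∀ (W : ℝ →ᵇ ℝ) s, |G s (W s)| ≤ C + L * ‖W‖ := fun W s => by
    have h1 := hlip s (W s) 0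
    have h2 := mul_le_mul_of_nonneg_left (W.norm_coe_le_norm s) hL
    rw [Real.norm_eq_abs] at h2
    rw [sub_zero] at h1
    have h3 := abs_sub_abs_le_abs_sub (G s (W s)) (G s 0)
    linarith [hC s]
  let T : (ℝ →ᵇ ℝ) → ℝ →ᵇ ℝ := fun W => BoundedContinuousFunction.ofNormedAddCommGroup
    (discountedTail K fun s => G s (W s)) (continuous_discountedTail hK (hGW W) (hbd W))
    ((C + L * ‖W‖) / K) (abs_discountedTail_le hK (hbd W))
  have hT : ContractingWith (L / K).toNNReal T := by
    refine ⟨by rw [Real.toNNReal_lt_one]; exact (div_lt_one hK).2 hLK, ?_⟩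
    refine LipschitzWith.of_dist_le_mul fun W W' => ?_
    rw [Real.coe_toNNReal _ (div_nonneg hL hK.le)]
    refine (BoundedContinuousFunction.dist_le
      (mul_nonneg (div_nonneg hL hK.le) dist_nonneg)).2 fun y => ?_
    rw [Real.dist_eq]
    change |discountedTail K _ y - discountedTail K _ y| ≤ _
    rw [discountedTail_sub hK (hGW W) (hbd W) (hGW W') (hbd W')]
    refine (abs_discountedTail_le hK (D := L * dist W W') (fun x => ?_) y).trans_eq (by ring)
    have : dist (W x) (W' x) ≤ dist W W' := BoundedContinuousFunction.dist_coe_le_dist x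
    exact (hlip x _ _).trans (mul_le_mul_of_nonneg_left this hL)
  refine ⟨ContractingWith.fixedPoint T hT, ?_⟩
  conv_lhs => rw [← hT.fixedPoint_isFixedPt.eq]
  rfl

end BoundedFunctions

/-! ### Lebesgue measure on the half line and the survival function -/

theorem measurableEmbedding_coe_nnreal : MeasurableEmbedding ((↑) : ℝ≥0 → ℝ) :=
  MeasurableEmbedding.subtype_coe measurableSet_Ici

theorem integral_leb (f : ℝ≥0 → ℝ) : ∫ t, f t ∂leb = ∫ x in Ioi (0 : ℝ), f x.toNNReal := by
  have h := integral_subtype_comap (μ := volume) (measurableSet_Ici (a := (0 : ℝ)))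
    (fun x : ℝ => f x.toNNReal)
  rw [← setIntegral_congr_set (Ioi_ae_eq_Ici (a := (0 : ℝ)) (μ := volume))] at h
  rw [← h]
  refine integral_congr_ae (Eventually.of_forall fun t => ?_)
  exact congrArg f (Real.toNNReal_coe (r := t)).symm

theorem leb_Iio (b : ℝ≥0) : leb (Iio b) = b := by
  rw [leb, measurableEmbedding_coe_nnreal.comap_apply]
  have : ((↑) : ℝ≥0 → ℝ) '' Iio b = Ico 0 (b : ℝ) := by
    ext x
    constructor
    · rintro ⟨y, hy, rfl⟩
      exact ⟨y.2, by exact_mod_cast hy⟩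
    · rintro ⟨h0, h1⟩
      exact ⟨⟨x, h0⟩, by exact_mod_cast h1, rfl⟩
  rw [this, Real.volume_Ico, sub_zero, ENNReal.ofReal_coe_nnreal]

instance : SigmaFinite leb :=
  ⟨⟨⟨fun n => Iio (n : ℝ≥0), fun _ => trivial, fun n => by simp [leb_Iio], by
    refine eq_univ_of_forall fun x => ?_
    obtain ⟨n, hn⟩ := exists_nat_gt x
    exact mem_iUnion.2 ⟨n, hn⟩⟩⟩⟩

instance : NullSingletonClass leb :=
  ⟨fun a => by
    rw [leb, measurableEmbedding_coe_nnreal.comap_apply, image_singleton, measure_singleton]⟩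

instance {U : Type*} [MeasurableSpace U] (r : Action U) : IsMarkovKernel r.1 := r.2

namespace Model

variable {S U : Type*} [MeasurableSpace U] (M : Model S U)

theorem exists_rate_bounds : ∃ m K : ℝ≥0, 0 < m ∧ m < K ∧
    (∀ i y v, (m : ℝ≥0∞) ≤ exitRate M.rate i y v) ∧ ∀ i y v, exitRate M.rate i y v ≤ K := by
  obtain ⟨K, hK⟩ := M.bounded
  obtain ⟨m, hm, hmq⟩ := M.bounded_below
  refine ⟨m, max K (m + 1), hm, lt_max_of_lt_right (lt_add_one m), fun i y v => ?_,
    fun i y v => ?_⟩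
  · exact hmq.le.trans ((iInf_le _ i).trans ((iInf_le _ y).trans (iInf_le _ v)))
  · refine ((le_iSup (fun v => exitRate M.rate i y v) v).trans
      ((le_iSup (fun y => ⨆ v, exitRate M.rate i y v) y).trans
        (le_iSup (fun i => ⨆ y, ⨆ v, exitRate M.rate i y v) i))).trans (hK.le.trans ?_)
    exact_mod_cast le_max_left _ _

variable (i : S) (r : Action U)

theorem measurable_rate_coe (j : {j : S // j ≠ i}) :
    Measurable fun p : ℝ≥0 × U => (M.rate i j p.1 p.2 : ℝ≥0∞) :=
  (M.measurable_rate i j j.2).coe_nnreal_ennreal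

theorem measurable_exitRate [Countable S] :
    Measurable fun p : ℝ≥0 × U => exitRate M.rate i p.1 p.2 :=
  Measurable.tsum fun j => M.measurable_rate_coe i j

theorem measurable_meanRate (j : {j : S // j ≠ i}) : Measurable (M.meanRate i j r) :=
  Measurable.lintegral_kernel_prod_right (κ := r.1)
    (f := fun y v => (M.rate i j y v : ℝ≥0∞)) (M.measurable_rate_coe i j)

theorem measurable_meanExitRate [Countable S] : Measurable (M.meanExitRate i r) :=
  Measurable.lintegral_kernel_prod_right (κ := r.1) (M.measurable_exitRate i)

theorem meanExitRate_eq_tsum [Countable S] (y : ℝ≥0) :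
    M.meanExitRate i r y = ∑' j : {j : S // j ≠ i}, M.meanRate i j r y :=
  lintegral_tsum fun j => ((M.measurable_rate_coe i j).comp measurable_prodMk_left).aemeasurable

variable {M i} in
theorem le_meanExitRate {m : ℝ≥0} (hm : ∀ y v, (m : ℝ≥0∞) ≤ exitRate M.rate i y v) (y : ℝ≥0) :
    (m : ℝ≥0∞) ≤ M.meanExitRate i r y := by
  have := lintegral_mono (μ := r.1 y) (fun v => hm y v)
  simpa [meanExitRate] using this

variable {M i} in
theorem meanExitRate_le {K : ℝ≥0} (hK : ∀ y v, exitRate M.rate i y v ≤ K) (y : ℝ≥0) :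
    M.meanExitRate i r y ≤ K := by
  have := lintegral_mono (μ := r.1 y) (fun v => hK y v)
  simpa [meanExitRate] using this

theorem meanExitRate_ne_top (y : ℝ≥0) : M.meanExitRate i r y ≠ ⊤ := by
  obtain ⟨m, K, -, -, -, hK⟩ := M.exists_rate_bounds
  exact ((meanExitRate_le r (hK i) y).trans_lt ENNReal.coe_lt_top).ne

theorem lintegral_meanExitRate_ne_top (t : ℝ≥0) :
    ∫⁻ s in Iio t, M.meanExitRate i r s ∂leb ≠ ⊤ := by
  obtain ⟨m, K, -, -, -, hK⟩ := M.exists_rate_bounds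
  refine ((lintegral_mono (meanExitRate_le r (hK i))).trans_lt ?_).ne
  rw [lintegral_const, Measure.restrict_apply_univ, leb_Iio]
  exact ENNReal.mul_lt_top ENNReal.coe_lt_top ENNReal.coe_lt_top

theorem antitone_survival : Antitone (M.survival i r) := fun _ b hab =>
  ENNReal.ofReal_le_ofReal (Real.exp_le_exp.2 (neg_le_neg
    (ENNReal.toReal_mono (M.lintegral_meanExitRate_ne_top i r b)
      (lintegral_mono_set (Iio_subset_Iio hab)))))

theorem measurable_survival : Measurable (M.survival i r) :=
  (M.antitone_survival i r).measurable

theorem lintegral_survival_mul_meanExitRate [Countable S] :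
    ∫⁻ t, M.survival i r t * M.meanExitRate i r t ∂leb = 1 := by
  obtain ⟨m, K, hm0, -, hm, hK⟩ := M.exists_rate_bounds
  exact lintegral_hazard (M.measurable_meanExitRate i r) hm0 (le_meanExitRate r (hm i))
    (meanExitRate_le r (hK i))

theorem tsum_transProb [Countable S] : ∑' j : {j : S // j ≠ i}, M.transProb i j r = 1 := by
  simp only [transProb]
  rw [← lintegral_tsum (f := fun (j : {j : S // j ≠ i}) t => M.survival i r t * M.meanRate i j r t)
    fun j => ((M.measurable_survival i r).mul (M.measurable_meanRate i r j)).aemeasurable]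
  simp only [ENNReal.tsum_mul_left, ← meanExitRate_eq_tsum]
  exact M.lintegral_survival_mul_meanExitRate i r

variable {M i} in
theorem mul_meanSojourn_le [Countable S] {m : ℝ≥0}
    (hm : ∀ y v, (m : ℝ≥0∞) ≤ exitRate M.rate i y v) : m * M.meanSojourn i r ≤ 1 := by
  rw [← M.lintegral_survival_mul_meanExitRate i r, meanSojourn,
    ← lintegral_const_mul _ (M.measurable_survival i r)]
  refine lintegral_mono fun t => ?_
  rw [mul_comm]
  gcongr
  exact le_meanExitRate r hm t

variable {M i} in
theorem one_le_mul_meanSojourn [Countable S] {K : ℝ≥0}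
    (hK : ∀ y v, exitRate M.rate i y v ≤ K) : 1 ≤ K * M.meanSojourn i r := by
  rw [← M.lintegral_survival_mul_meanExitRate i r, meanSojourn,
    ← lintegral_const_mul _ (M.measurable_survival i r)]
  refine lintegral_mono fun t => ?_
  rw [mul_comm (K : ℝ≥0∞)]
  gcongr
  exact meanExitRate_le r hK t

theorem meanSojourn_ne_top [Countable S] : M.meanSojourn i r ≠ ⊤ := by
  obtain ⟨m, K, hm0, -, hm, hK⟩ := M.exists_rate_bounds
  intro h
  have := mul_meanSojourn_le r (hm i)
  rw [h, ENNReal.mul_top (by exact_mod_cast hm0.ne')] at this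
  simp at this

/-- The survival function as a function of a real age, with an interval integral in the exponent. -/
theorem survival_toNNReal [Countable S] {x : ℝ} (hx : 0 ≤ x) :
    M.survival i r x.toNNReal = ENNReal.ofReal
      (Real.exp (-∫ s in (0 : ℝ)..x, (M.meanExitRate i r s.toNNReal).toReal)) := by
  rw [survival, ← integral_toReal (M.measurable_meanExitRate i r).aemeasurable
    (Eventually.of_forall fun s => (M.meanExitRate_ne_top i r s).lt_top),
    ← integral_indicator measurableSet_Iio, integral_leb, intervalIntegral.integral_of_le hx,
    integral_Ioc_eq_integral_Ioo, ← integral_indicator measurableSet_Ioi,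
    ← integral_indicator measurableSet_Ioo]
  congr 3
  refine integral_congr_ae (Eventually.of_forall fun s => ?_)
  by_cases h0 : 0 < s
  · have : s.toNNReal < x.toNNReal ↔ s < x := Real.toNNReal_lt_toNNReal_iff_of_nonneg h0.le
    by_cases h2 : s < x <;> simp [indicator, h0, h2, this]
  · simp [indicator, h0]

end Model

/-! ### The bracket as an integral against the occupation measure of a stage -/

namespace Model

variable {S U : Type*} [MeasurableSpace U] (M : Model S U) (i : S) (r : Action U)

/-- The occupation measure of a stage started in `i` under `r`: the expected time spent at ages in
a set, with actions in a set, before the next jump. -/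
noncomputable def stageMeasure : Measure (ℝ≥0 × U) :=
  (leb.withDensity (M.survival i r)) ⊗ₘ r.1

instance [Countable S] : IsFiniteMeasure (leb.withDensity (M.survival i r)) :=
  isFiniteMeasure_withDensity (M.meanSojourn_ne_top i r)

instance [Countable S] : IsFiniteMeasure (M.stageMeasure i r) := by
  rw [stageMeasure]; infer_instance

/-- Integration against the occupation measure: first over the actions at age `y`, then over the
ages weighted with the probability of no jump. -/
theorem lintegral_stageMeasure [Countable S] {f : ℝ≥0 × U → ℝ≥0∞} (hf : Measurable f) :
    ∫⁻ p, f p ∂(M.stageMeasure i r) = ∫⁻ y, M.survival i r y * ∫⁻ v, f (y, v) ∂(r.1 y) ∂leb := by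
  rw [stageMeasure, Measure.lintegral_compProd hf,
    lintegral_withDensity_eq_lintegral_mul _ (M.measurable_survival i r)
      (hf.lintegral_kernel_prod_right')]
  rfl

theorem stageMeasure_univ [Countable S] : M.stageMeasure i r univ = M.meanSojourn i r := by
  rw [← lintegral_one, lintegral_stageMeasure _ _ _ measurable_const]
  simp [meanSojourn]

theorem summable_transProb [Countable S] :
    Summable fun j : {j : S // j ≠ i} => (M.transProb i j r).toReal :=
  ENNReal.summable_toReal (by rw [tsum_transProb]; simp)

/-- The running cost `c(i, y, v) + ∑_{j ≠ i} λ_ij(y, v) ψ(j) - ρ` whose expected integral over a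
stage is the bracket. -/
noncomputable def stageRate (ψ : S → ℝ) (ρ : ℝ) (y : ℝ≥0) (v : U) : ℝ :=
  M.cost i y v + (∑' j : {j : S // j ≠ i}, M.rate i j y v * ψ j) - ρ

theorem summable_rate (y : ℝ≥0) (v : U) :
    Summable fun j : {j : S // j ≠ i} => (M.rate i j y v : ℝ) := by
  obtain ⟨m, K, -, -, -, hK⟩ := M.exists_rate_bounds
  exact ENNReal.summable_toReal (f := fun j : {j : S // j ≠ i} => (M.rate i j y v : ℝ≥0∞))
    ((hK i y v).trans_lt ENNReal.coe_lt_top).ne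

theorem exitRate_toReal (y : ℝ≥0) (v : U) :
    (exitRate M.rate i y v).toReal = ∑' j : {j : S // j ≠ i}, (M.rate i j y v : ℝ) := by
  rw [exitRate, ENNReal.tsum_toReal_eq (fun _ => ENNReal.coe_ne_top)]
  rfl

theorem summable_rate_mul {ψ : S → ℝ} {B : ℝ} (hB : ∀ j, |ψ j| ≤ B) (y : ℝ≥0) (v : U) :
    Summable fun j : {j : S // j ≠ i} => M.rate i j y v * ψ j := by
  refine Summable.of_norm_bounded ((M.summable_rate i y v).mul_right B) fun j => ?_
  rw [norm_mul, Real.norm_of_nonneg (NNReal.coe_nonneg _)]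
  exact mul_le_mul_of_nonneg_left (hB j) (NNReal.coe_nonneg _)

theorem abs_tsum_rate_mul_le {ψ : S → ℝ} {B : ℝ} (hB : ∀ j, |ψ j| ≤ B) (y : ℝ≥0) (v : U) :
    |∑' j : {j : S // j ≠ i}, M.rate i j y v * ψ j| ≤ (exitRate M.rate i y v).toReal * B := by
  rw [exitRate_toReal, ← tsum_mul_right]
  rw [← Real.norm_eq_abs]
  refine tsum_of_norm_bounded (((M.summable_rate i y v).mul_right B).hasSum) fun j => ?_
  rw [norm_mul, Real.norm_of_nonneg (NNReal.coe_nonneg _)]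
  exact mul_le_mul_of_nonneg_left (hB j) (NNReal.coe_nonneg _)

theorem exists_abs_stageRate_le {ψ : S → ℝ} {B : ℝ} (hB : ∀ j, |ψ j| ≤ B) (ρ : ℝ) {C : ℝ≥0}
    (hC : ∀ y v, M.cost i y v ≤ C) : ∃ D, ∀ y v, |M.stageRate i ψ ρ y v| ≤ D := by
  obtain ⟨m, K, -, -, -, hK⟩ := M.exists_rate_bounds
  refine ⟨C + K * B + |ρ|, fun y v => ?_⟩
  have hB0 : 0 ≤ B := (abs_nonneg _).trans (hB i)
  refine (abs_sub _ _).trans (add_le_add_left ((abs_add_le _ _).trans (add_le_add ?_ ?_)) _)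
  · rw [abs_of_nonneg (NNReal.coe_nonneg _)]
    exact_mod_cast hC y v
  · refine (M.abs_tsum_rate_mul_le i hB y v).trans (mul_le_mul_of_nonneg_right ?_ hB0)
    exact ENNReal.toReal_mono ENNReal.coe_ne_top (hK i y v)

theorem measurable_tsum_rate_mul [Countable S] (ψ : S → ℝ) :
    Measurable fun p : ℝ≥0 × U => ∑' j : {j : S // j ≠ i}, (M.rate i j p.1 p.2 : ℝ) * ψ j :=
  Measurable.tsum (f := fun (j : {j : S // j ≠ i}) (p : ℝ≥0 × U) =>
    (M.rate i j p.1 p.2 : ℝ) * ψ j) fun j : {j : S // j ≠ i} =>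
    (M.measurable_rate i j j.2).coe_nnreal_real.mul_const (ψ j)

theorem measurable_stageRate [Countable S]
    (hc : Measurable fun p : ℝ≥0 × U => M.cost i p.1 p.2) (ψ : S → ℝ) (ρ : ℝ) :
    Measurable fun p : ℝ≥0 × U => M.stageRate i ψ ρ p.1 p.2 :=
  (hc.coe_nnreal_real.add (M.measurable_tsum_rate_mul i ψ)).sub_const _

theorem integrable_and_integral_rate [Countable S] (j : {j : S // j ≠ i}) :
    Integrable (fun p : ℝ≥0 × U => (M.rate i j p.1 p.2 : ℝ)) (M.stageMeasure i r) ∧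
    ∫ p, (M.rate i j p.1 p.2 : ℝ) ∂(M.stageMeasure i r) = (M.transProb i j r).toReal := by
  have h : ∫⁻ p, (M.rate i j p.1 p.2 : ℝ≥0∞) ∂(M.stageMeasure i r) = M.transProb i j r :=
    M.lintegral_stageMeasure i r (M.measurable_rate_coe i j)
  have htop : ∫⁻ p, (M.rate i j p.1 p.2 : ℝ≥0∞) ∂(M.stageMeasure i r) ≠ ⊤ := by
    rw [h]
    exact ENNReal.ne_top_of_tsum_ne_top (by rw [M.tsum_transProb i r]; simp) j
  refine ⟨integrable_toReal_of_lintegral_ne_top (M.measurable_rate_coe i j).aemeasurable htop, ?_⟩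
  rw [← h, ← integral_toReal (M.measurable_rate_coe i j).aemeasurable
    (Eventually.of_forall fun _ => ENNReal.coe_lt_top)]
  rfl

/-- The bracket is the expected integral of `stageRate` over a stage; the sum over the next states
is interchanged with the integral because the transition probabilities sum to one. -/
theorem bracket_eq_integral [Countable S]
    (hc : Measurable fun p : ℝ≥0 × U => M.cost i p.1 p.2) {C : ℝ≥0}
    (hC : ∀ y v, M.cost i y v ≤ C) {ψ : S → ℝ} {B : ℝ} (hB : ∀ j, |ψ j| ≤ B) (ρ : ℝ) :
    M.bracket ψ ρ i r = ∫ p, M.stageRate i ψ ρ p.1 p.2 ∂(M.stageMeasure i r) := by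
  obtain ⟨m, K, -, -, -, hK⟩ := M.exists_rate_bounds
  have hcost : ∫ p, (M.cost i p.1 p.2 : ℝ) ∂(M.stageMeasure i r) = (M.stageCost i r).toReal := by
    have h : ∫⁻ p, (M.cost i p.1 p.2 : ℝ≥0∞) ∂(M.stageMeasure i r) = M.stageCost i r :=
      M.lintegral_stageMeasure i r hc.coe_nnreal_ennreal
    rw [← h, ← integral_toReal hc.coe_nnreal_ennreal.aemeasurable
      (Eventually.of_forall fun _ => ENNReal.coe_lt_top)]
    rfl
  have hcint : Integrable (fun p : ℝ≥0 × U => (M.cost i p.1 p.2 : ℝ)) (M.stageMeasure i r) :=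
    Integrable.of_bound hc.coe_nnreal_real.aestronglyMeasurable C
      (Eventually.of_forall fun p => by
        rw [Real.norm_of_nonneg (NNReal.coe_nonneg _)]; exact_mod_cast hC _ _)
  have hsum : HasSum (fun j : {j : S // j ≠ i} => (M.transProb i j r).toReal * ψ j)
      (∫ p, ∑' j : {j : S // j ≠ i}, M.rate i j p.1 p.2 * ψ j ∂(M.stageMeasure i r)) := by
    have h := hasSum_integral_of_summable_integral_norm (μ := M.stageMeasure i r)
      (F := fun (j : {j : S // j ≠ i}) (p : ℝ≥0 × U) => (M.rate i j p.1 p.2 : ℝ) * ψ j)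
      (fun j => (M.integrable_and_integral_rate i r j).1.mul_const _) ?_
    · simpa only [integral_mul_const, (M.integrable_and_integral_rate i r _).2] using h
    · simp only [norm_mul, Real.norm_of_nonneg (NNReal.coe_nonneg _), integral_mul_const,
        (M.integrable_and_integral_rate i r _).2]
      exact Summable.of_nonneg_of_le (fun j => mul_nonneg ENNReal.toReal_nonneg (norm_nonneg _))
        (fun j => mul_le_mul_of_nonneg_left (hB j) ENNReal.toReal_nonneg)
        ((M.summable_transProb i r).mul_right B)
  have hsint : Integrable (fun p : ℝ≥0 × U => ∑' j : {j : S // j ≠ i}, M.rate i j p.1 p.2 * ψ j)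
      (M.stageMeasure i r) := by
    refine Integrable.of_bound (C := K * B) (M.measurable_tsum_rate_mul i ψ).aestronglyMeasurable
      (Eventually.of_forall fun p => (M.abs_tsum_rate_mul_le i hB p.1 p.2).trans ?_)
    exact mul_le_mul_of_nonneg_right (ENNReal.toReal_mono ENNReal.coe_ne_top (hK i _ _))
      ((abs_nonneg _).trans (hB i))
  rw [bracket, ← hcost, hsum.tsum_eq]
  simp only [stageRate]
  rw [integral_sub (by exact hcint.add hsint) (integrable_const _), integral_add hcint hsint,
    integral_const, measureReal_def, stageMeasure_univ, smul_eq_mul, mul_comm ρ]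

theorem integral_exitRate [Countable S] (y : ℝ≥0) :
    ∫ v, (exitRate M.rate i y v).toReal ∂(r.1 y) = (M.meanExitRate i r y).toReal := by
  obtain ⟨m, K, -, -, -, hK⟩ := M.exists_rate_bounds
  exact integral_toReal ((M.measurable_exitRate i).comp measurable_prodMk_left).aemeasurable
    (Eventually.of_forall fun v => (hK i y v).trans_lt ENNReal.coe_lt_top)

theorem integral_stageMeasure [Countable S] {f : ℝ≥0 × U → ℝ}
    (hf : Integrable f (M.stageMeasure i r)) :
    ∫ p, f p ∂(M.stageMeasure i r) = ∫ x in Ioi (0 : ℝ),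
      Real.exp (-∫ s in (0 : ℝ)..x, (M.meanExitRate i r s.toNNReal).toReal) *
        ∫ v, f (x.toNNReal, v) ∂(r.1 x.toNNReal) := by
  rw [stageMeasure, Measure.integral_compProd hf,
    integral_withDensity_eq_integral_toReal_smul (M.measurable_survival i r)
      (Eventually.of_forall fun _ => ENNReal.ofReal_lt_top), integral_leb]
  refine setIntegral_congr_fun measurableSet_Ioi fun x hx => ?_
  rw [survival_toNNReal _ _ _ (le_of_lt hx), ENNReal.toReal_ofReal (Real.exp_pos _).le, smul_eq_mul]

end Model

/-! ### Existence of minimizers -/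

namespace Model

section Continuity

variable {S U : Type*} [MeasurableSpace U] [TopologicalSpace U] {M : Model S U}

theorem continuous_exitRate_toReal (h : M.ContinuousRates) (i : S) (y : ℝ≥0) :
    Continuous fun v => (exitRate M.rate i y v).toReal := by
  have hc : Continuous fun p : ℝ≥0 × U => ∑' j : {j : S // j ≠ i}, M.rate i j p.1 p.2 :=
    (h.2 i).continuous (Eventually.of_forall fun F =>
      continuous_finsetSum _ fun (j : {j : S // j ≠ i}) _ => h.1 i j j.2).frequently
  have hc' := NNReal.continuous_coe.comp (hc.comp (Continuous.prodMk_right y))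
  refine hc'.congr fun v => ?_
  rw [exitRate_toReal]
  simp only [Function.comp]
  rw [NNReal.coe_tsum]

/-- Uniform convergence of the rates carries over to the sums weighted with a bounded function. -/
theorem continuous_tsum_rate_mul (h : M.ContinuousRates) (i : S) {ψ : S → ℝ} {B : ℝ}
    (hB : ∀ j, |ψ j| ≤ B) (y : ℝ≥0) :
    Continuous fun v => ∑' j : {j : S // j ≠ i}, (M.rate i j y v : ℝ) * ψ j := by
  have hB0 : 0 ≤ B := (abs_nonneg _).trans (hB i)
  have hu : TendstoUniformly
      (fun (F : Finset {j : S // j ≠ i}) v => ∑ j ∈ F, (M.rate i j y v : ℝ) * ψ j)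
      (fun v => ∑' j : {j : S // j ≠ i}, (M.rate i j y v : ℝ) * ψ j) atTop := by
    rw [Metric.tendstoUniformly_iff]
    intro ε hε
    have h1 := Metric.tendstoUniformly_iff.1 (h.2 i) (ε / (B + 1)) (by positivity)
    filter_upwards [h1] with F hF v
    have hF := hF (y, v)
    rw [NNReal.dist_eq, NNReal.coe_tsum, NNReal.coe_sum] at hF
    have hs := M.summable_rate i y v
    have hsψ := M.summable_rate_mul i hB y v
    -- both signs of the tail are dominated by `B` times the tail of the total rate
    have key : ∀ c : S → ℝ, (∀ j, |c j| ≤ B) → (Summable fun j : {j : S // j ≠ i} =>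
        (M.rate i j y v : ℝ) * c j) →
        (∑' j : {j : S // j ≠ i}, (M.rate i j y v : ℝ) * c j)
            - ∑ j ∈ F, (M.rate i j y v : ℝ) * c j
          ≤ B * ((∑' j : {j : S // j ≠ i}, (M.rate i j y v : ℝ))
            - ∑ j ∈ F, (M.rate i j y v : ℝ)) := by
      intro c hc hsc
      have h2 := ((hs.mul_left B).sub hsc).sum_le_tsum F fun j _ => by
        have := (abs_le.1 (hc j)).2
        have := NNReal.coe_nonneg (M.rate i j y v)
        nlinarith
      rw [(hs.mul_left B).tsum_sub hsc, Finset.sum_sub_distrib, tsum_mul_left,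
        ← Finset.mul_sum] at h2
      linarith
    have k1 := key ψ hB hsψ
    have k2 := key (fun j => -ψ j) (fun j => by rw [abs_neg]; exact hB j) (by
      simpa only [mul_neg] using hsψ.neg)
    simp only [mul_neg, Finset.sum_neg_distrib, tsum_neg] at k2
    have h3 := (abs_lt.1 hF).2
    have h4 : B * ((∑' j : {j : S // j ≠ i}, (M.rate i j y v : ℝ))
        - ∑ j ∈ F, (M.rate i j y v : ℝ)) < ε := by
      refine (mul_le_mul_of_nonneg_left h3.le hB0).trans_lt ?_
      rw [← mul_div_assoc, div_lt_iff₀ (by positivity)]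
      linarith
    rw [Real.dist_eq, abs_lt]
    constructor <;> linarith
  refine hu.continuous
    (Eventually.of_forall fun F => continuous_finsetSum _ fun j _ => ?_).frequently
  exact ((NNReal.continuous_coe.comp (h.1 i j j.2)).comp (Continuous.prodMk_right y)).mul_const _

theorem continuous_stageRate (h : M.ContinuousRates) (hc : M.ContinuousBoundedCost) (i : S)
    {ψ : S → ℝ} {B : ℝ} (hB : ∀ j, |ψ j| ≤ B) (ρ : ℝ) (y : ℝ≥0) :
    Continuous (M.stageRate i ψ ρ y) :=
  ((NNReal.continuous_coe.comp (hc.2.1 i y)).add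
    (continuous_tsum_rate_mul h i hB y)).sub continuous_const

end Continuity

variable {S U : Type*} [Countable S] [MetricSpace U] [CompactSpace U] [MeasurableSpace U]
  [BorelSpace U] {M : Model S U}

omit [Countable S] in
theorem measurable_cost (hc : M.ContinuousBoundedCost) (i : S) :
    Measurable fun p : ℝ≥0 × U => M.cost i p.1 p.2 :=
  (measurable_uncurry_of_continuous_of_measurable (u := fun v y => M.cost i y v)
    (fun y => hc.2.1 i y) (fun v => (hc.1 i v).measurable)).comp measurable_swap

/-- A bounded solution `W` of the dynamic programming equation `W' = -k`, where
`k(y) = min_v (ℓ(y, v) - q(y, v) W(y))`, with a measurable selector `s` of the minimizers. The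
functions `W` and `k` live on `ℝ`, where the coefficients are extended constantly to the negative
half line. -/
theorem exists_value_function [Nonempty U] (hr : M.ContinuousRates) (hc : M.ContinuousBoundedCost)
    {ψ : S → ℝ} {B : ℝ} (hB : ∀ j, |ψ j| ≤ B) (ρ : ℝ) (i : S) :
    ∃ (W k : ℝ → ℝ) (A D : ℝ) (s : ℝ≥0 → U), Continuous W ∧ (∀ x, |W x| ≤ A) ∧
      (∀ a b, AbsolutelyContinuousOnInterval W a b) ∧ Measurable k ∧ (∀ x, |k x| ≤ D) ∧
      (∀ᵐ x, HasDerivAt W (-k x) x) ∧ Measurable s ∧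
      (∀ (y : ℝ≥0) v, k y ≤ M.stageRate i ψ ρ y v - (exitRate M.rate i y v).toReal * W y) ∧
      ∀ y : ℝ≥0, k y = M.stageRate i ψ ρ y (s y) - (exitRate M.rate i y (s y)).toReal * W y := by
  obtain ⟨m, K, hm0, hmK, hm, hK⟩ := M.exists_rate_bounds
  obtain ⟨C, hC⟩ := hc.2.2
  obtain ⟨D, hD⟩ := M.exists_abs_stageRate_le i hB ρ (hC i)
  set ℓ := M.stageRate i ψ ρ with hℓ
  set q : ℝ≥0 → U → ℝ := fun y v => (exitRate M.rate i y v).toReal with hq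
  have hqm : ∀ y v, (m : ℝ) ≤ q y v := fun y v =>
    ENNReal.toReal_mono (((hK i y v).trans_lt ENNReal.coe_lt_top).ne) (hm i y v)
  have hqK : ∀ y v, q y v ≤ K := fun y v => ENNReal.toReal_mono ENNReal.coe_ne_top (hK i y v)
  have hℓm : Measurable fun p : ℝ≥0 × U => ℓ p.1 p.2 :=
    M.measurable_stageRate i (measurable_cost hc i) ψ ρ
  have hqmeas : Measurable fun p : ℝ≥0 × U => q p.1 p.2 := (M.measurable_exitRate i).ennreal_toReal
  have hℓc : ∀ y, Continuous (ℓ y) := continuous_stageRate hr hc i hB ρ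
  have hqc : ∀ y, Continuous (q y) := continuous_exitRate_toReal hr i
  -- `G x w` is the minimum over `v` of `ℓ + (K - q) w`; a measurable minimizer for each fixed `w`
  -- makes it measurable in `x`
  have hsel : ∀ w : ℝ, ∃ s : ℝ≥0 → U, Measurable s ∧
      ∀ y v, ℓ y (s y) + (K - q y (s y)) * w ≤ ℓ y v + (K - q y v) * w := fun w =>
    exists_measurable_argmin (fun y v => ℓ y v + (K - q y v) * w)
      (fun y => (hℓc y).add ((continuous_const.sub (hqc y)).mul_const w))
      (fun v => (hℓm.comp measurable_prodMk_right).add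
        ((measurable_const.sub (hqmeas.comp measurable_prodMk_right)).mul_const w))
  choose σ hσm hσ using hsel
  let G : ℝ → ℝ → ℝ := fun x w =>
    ℓ x.toNNReal (σ w x.toNNReal) + (K - q x.toNNReal (σ w x.toNNReal)) * w
  have hGle : ∀ x w w', G x w - G x w' ≤ (K - m) * |w - w'| := fun x w w' => by
    have h1 := hσ w x.toNNReal (σ w' x.toNNReal)
    have h2 : (K - q x.toNNReal (σ w' x.toNNReal)) * (w - w') ≤ (K - m) * |w - w'| :=
      (mul_le_mul_of_nonneg_left (le_abs_self _) (sub_nonneg.2 (hqK _ _))).trans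
        (mul_le_mul_of_nonneg_right (sub_le_sub_left (hqm _ _) _) (abs_nonneg _))
    simp only [G]
    linarith
  have hKm : (0 : ℝ) ≤ K - m := sub_nonneg.2 (by exact_mod_cast hmK.le)
  have hlip : ∀ x w w', |G x w - G x w'| ≤ (K - m) * |w - w'| := fun x w w' => by
    have h1 := hGle x w w'
    have h2 := hGle x w' w
    rw [abs_sub_comm w' w] at h2
    exact abs_le.2 ⟨by linarith, h1⟩
  have hGm : ∀ w, Measurable fun x => G x w := fun w => by
    have h1 : Measurable fun x : ℝ => (x.toNNReal, σ w x.toNNReal) :=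
      measurable_real_toNNReal.prodMk ((hσm w).comp measurable_real_toNNReal)
    exact (hℓm.comp h1).add ((measurable_const.sub (hqmeas.comp h1)).mul_const w)
  have hG0 : ∀ x, |G x 0| ≤ D := fun x => by simpa [G] using hD _ _
  obtain ⟨W, hW⟩ := exists_eq_discountedTail hKm (sub_lt_self (K : ℝ) (by exact_mod_cast hm0))
    G hGm hlip hG0
  have hK0 : (0 : ℝ) < K := by exact_mod_cast hm0.trans hmK
  have hGc : ∀ x, Continuous (G x) := fun x =>
    (LipschitzWith.of_dist_le_mul (K := ((K : ℝ) - m).toNNReal) fun w w' => by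
      rw [Real.dist_eq, Real.dist_eq, Real.coe_toNNReal _ hKm]; exact hlip x w w').continuous
  have hGW : Measurable fun x => G x (W x) :=
    (measurable_uncurry_of_continuous_of_measurable (u := fun w x => G x w) hGc hGm).comp
      (W.continuous.measurable.prodMk measurable_id)
  have hWb : ∀ x, |W x| ≤ ‖W‖ := fun x => W.norm_coe_le_norm x
  have hGb : ∀ x, |G x (W x)| ≤ D + (K - m) * ‖W‖ := fun x => by
    have h1 := hlip x (W x) 0
    have h2 := mul_le_mul_of_nonneg_left (hWb x) hKm
    rw [sub_zero] at h1
    have h3 := abs_sub_abs_le_abs_sub (G x (W x)) (G x 0)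
    linarith [hG0 x]
  -- the selectors `σ w` need not be jointly measurable in `w`, so the minimizer along `w = W y` is
  -- selected anew
  obtain ⟨s, hsm, hs⟩ := exists_measurable_argmin
    (fun (y : ℝ≥0) v => ℓ y v + (K - q y v) * W y)
    (fun y => (hℓc y).add ((continuous_const.sub (hqc y)).mul_const _))
    (fun v => (hℓm.comp measurable_prodMk_right).add
      ((measurable_const.sub (hqmeas.comp measurable_prodMk_right)).mul
        (W.continuous.comp NNReal.continuous_coe).measurable))
  have hGy : ∀ y : ℝ≥0, G y (W y) = ℓ y (σ (W y) y) + (K - q y (σ (W y) y)) * W y := fun y => by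
    simp only [G, Real.toNNReal_coe]
  refine ⟨W, fun x => G x (W x) - K * W x, ‖W‖, D + (K - m) * ‖W‖ + K * ‖W‖, s, W.continuous,
    hWb, fun a b => ?_, hGW.sub (W.continuous.measurable.const_mul _), fun x => ?_, ?_, hsm,
    fun y v => ?_, fun y => ?_⟩
  · rw [hW]
    exact absolutelyContinuousOnInterval_discountedTail hK0 hGW hGb a b
  · refine (abs_sub _ _).trans (add_le_add (hGb x) ?_)
    rw [abs_mul, abs_of_pos hK0]
    exact mul_le_mul_of_nonneg_left (hWb x) hK0.le
  · filter_upwards [ae_hasDerivAt_discountedTail hK0 hGW hGb] with x hx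
    rw [← hW] at hx
    exact hx.congr_deriv (by ring)
  · have := hσ (W y) y v
    simp only [hGy]
    linarith
  · have h1 := hσ (W y) y (s y)
    have h2 := hs y (σ (W y) y)
    simp only [hGy]
    linarith

/-- The non-randomized action that uses `s y` at age `y`. -/
noncomputable def diracAction (s : ℝ≥0 → U) (hs : Measurable s) : Action U :=
  ⟨Kernel.deterministic s hs, inferInstance⟩

/-- The Dirac action at a pointwise minimizer of `ℓ - q W` minimizes the bracket, because
`bracket - W 0` is the integral of the nonnegative function `ℓ - q W - k`. -/
theorem exists_isMinimizer [Nonempty U] (hr : M.ContinuousRates) (hc : M.ContinuousBoundedCost)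
    {ψ : S → ℝ} {B : ℝ} (hB : ∀ j, |ψ j| ≤ B) (ρ : ℝ) (i : S) :
    ∃ r, M.IsMinimizer ψ ρ i r := by
  obtain ⟨m, K, hm0, hmK, hm, hK⟩ := M.exists_rate_bounds
  obtain ⟨C, hC⟩ := hc.2.2
  obtain ⟨E, hE⟩ := M.exists_abs_stageRate_le i hB ρ (hC i)
  obtain ⟨W, k, A, D, s, hWc, hWA, hWac, hkm, hkD, hWder, hsm, hle, heq⟩ :=
    exists_value_function hr hc hB ρ i
  have hqm : Measurable fun p : ℝ≥0 × U => (exitRate M.rate i p.1 p.2).toReal :=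
    (M.measurable_exitRate i).ennreal_toReal
  have hq0 : ∀ y v, |(exitRate M.rate i y v).toReal| ≤ K := fun y v => by
    rw [abs_of_nonneg ENNReal.toReal_nonneg]
    exact ENNReal.toReal_mono ENNReal.coe_ne_top (hK i y v)
  have hWm : Measurable fun y : ℝ≥0 => W y := (hWc.comp NNReal.continuous_coe).measurable
  have hkm' : Measurable fun y : ℝ≥0 => k y := hkm.comp NNReal.continuous_coe.measurable
  -- the expected integral of `q W + k` over a stage is `W 0` for every action
  have hI : ∀ r : Action U, Integrable
      (fun p : ℝ≥0 × U => (exitRate M.rate i p.1 p.2).toReal * W p.1 + k p.1)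
      (M.stageMeasure i r) := fun r => by
    refine Integrable.of_bound (C := K * A + D) ((hqm.mul (hWm.comp measurable_fst)).add
      (hkm'.comp measurable_fst)).aestronglyMeasurable (Eventually.of_forall fun p => ?_)
    refine (norm_add_le _ _).trans (add_le_add ?_ (hkD _))
    rw [norm_mul]
    exact mul_le_mul (hq0 _ _) (hWA _) (norm_nonneg _) K.2
  have hℓI : ∀ r : Action U, Integrable (fun p : ℝ≥0 × U => M.stageRate i ψ ρ p.1 p.2)
      (M.stageMeasure i r) := fun r => Integrable.of_bound (C := E)
    (M.measurable_stageRate i (measurable_cost hc i) ψ ρ).aestronglyMeasurable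
    (Eventually.of_forall fun p => hE _ _)
  have hdiff : ∀ r : Action U, M.bracket ψ ρ i r - W 0 = ∫ p, (M.stageRate i ψ ρ p.1 p.2
      - ((exitRate M.rate i p.1 p.2).toReal * W p.1 + k p.1)) ∂(M.stageMeasure i r) := by
    intro r
    rw [integral_sub (hℓI r) (hI r),
      ← M.bracket_eq_integral i r (measurable_cost hc i) (hC i) hB ρ,
      M.integral_stageMeasure i r (hI r)]
    congr 1
    have hfm : Measurable fun x : ℝ => (M.meanExitRate i r x.toNNReal).toReal :=
      ((M.measurable_meanExitRate i r).comp measurable_real_toNNReal).ennreal_toReal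
    refine (integral_exp_neg_primitive_mul hfm (m := m) (K := K) (by exact_mod_cast hm0)
      (fun x => ?_) (fun x => ?_) hkm hkD hWA hWc (fun b _ => hWac 0 b) hWder).symm.trans ?_
    · exact ENNReal.toReal_mono (M.meanExitRate_ne_top i r _) (le_meanExitRate r (hm i) _)
    · rw [abs_of_nonneg ENNReal.toReal_nonneg]
      exact ENNReal.toReal_mono ENNReal.coe_ne_top (meanExitRate_le r (hK i) _)
    · refine setIntegral_congr_fun measurableSet_Ioi fun x hx => ?_
      simp only [Real.coe_toNNReal x (le_of_lt hx)]
      have hqI : Integrable (fun v => (exitRate M.rate i x.toNNReal v).toReal)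
          (r.1 x.toNNReal) :=
        Integrable.of_bound (hqm.comp measurable_prodMk_left).aestronglyMeasurable K
          (Eventually.of_forall fun v => hq0 _ v)
      rw [integral_add (hqI.mul_const (W x)) (integrable_const _), integral_mul_const,
        integral_exitRate, integral_const]
      simp
  refine ⟨diracAction s hsm, fun r => ?_⟩
  have h1 : M.bracket ψ ρ i (diracAction s hsm) - W 0 = 0 := by
    rw [hdiff, M.integral_stageMeasure i _ (by exact (hℓI _).sub (hI _))]
    refine integral_eq_zero_of_ae (Eventually.of_forall fun x => ?_)
    have hF : Measurable fun v => M.stageRate i ψ ρ x.toNNReal v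
        - ((exitRate M.rate i x.toNNReal v).toReal * W x.toNNReal + k x.toNNReal) :=
      (((M.measurable_stageRate i (measurable_cost hc i) ψ ρ).comp measurable_prodMk_left).sub
        (((hqm.comp measurable_prodMk_left).mul_const _).add_const _))
    simp only [diracAction, Kernel.deterministic_apply, Pi.zero_apply]
    rw [integral_dirac' _ _ hF.stronglyMeasurable, heq]
    ring
  have h2 : 0 ≤ M.bracket ψ ρ i r - W 0 := by
    rw [hdiff]
    exact integral_nonneg fun p => by
      have := hle p.1 p.2
      simp only [Pi.zero_apply]
      linarith
  linarith

end Model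

/-! ### Paths and the law of one jump -/

/-- Translation invariance of Lebesgue measure on the half line. -/
theorem setLIntegral_Ici_leb (F : ℝ≥0 → ℝ≥0∞) (a : ℝ≥0) :
    ∫⁻ t in Ici a, F t ∂leb = ∫⁻ s, F (a + s) ∂leb := by
  rw [← lintegral_indicator measurableSet_Ici, lintegral_leb, lintegral_leb,
    ← lintegral_indicator measurableSet_Ioi, ← lintegral_indicator measurableSet_Ioi,
    ← lintegral_add_right_eq_self _ (a : ℝ)]
  refine lintegral_congr_ae ?_
  have h0 : ∀ᵐ x : ℝ, x ≠ 0 := by simp [ae_iff]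
  filter_upwards [h0] with x hx0
  rcases hx0.lt_or_gt with hx | hx
  · by_cases h2 : 0 < x + a
    · have h1 : ¬ a ≤ (x + a).toNNReal := by
        rw [not_le, ← NNReal.coe_lt_coe, Real.coe_toNNReal _ h2.le]
        linarith
      simp [indicator, not_lt.2 hx.le, h1]
    · simp [indicator, not_lt.2 hx.le, h2]
  · have h1 : (x + a).toNNReal = a + x.toNNReal := by
      rw [Real.toNNReal_add hx.le a.coe_nonneg, add_comm, Real.toNNReal_coe]
    have h2 : (0 : ℝ) < x + a := add_pos_of_pos_of_nonneg hx a.2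
    simp only [indicator, mem_Ioi, hx, h2, if_true, h1, mem_Ici, le_add_iff_nonneg_right, zero_le]

theorem setLIntegral_Ico_sub (f : ℝ≥0 → ℝ≥0∞) (a b : ℝ≥0) :
    ∫⁻ t in Ico a (a + b), f (t - a) ∂leb = ∫⁻ s in Iio b, f s ∂leb := by
  have h : Ico a (a + b) = Ici a ∩ Iio (a + b) := Ici_inter_Iio.symm
  rw [h, inter_comm, ← setLIntegral_indicator measurableSet_Iio, setLIntegral_Ici_leb,
    ← lintegral_indicator measurableSet_Iio]
  refine lintegral_congr fun s => ?_
  simp [indicator]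

section Path

variable {S : Type*} (ω : ℕ → S × ℝ≥0)

theorem jumpTime_succ (n : ℕ) : jumpTime ω (n + 1) = jumpTime ω n + (ω (n + 1)).2 :=
  Finset.sum_range_succ _ _

theorem monotone_jumpTime : Monotone (jumpTime ω) :=
  monotone_nat_of_le_succ fun n => by rw [jumpTime_succ]; exact le_self_add

theorem jumpCount_eq {n : ℕ} {t : ℝ≥0} (h : jumpTime ω n ≤ t) (h' : t < jumpTime ω (n + 1)) :
    jumpCount ω t = n := by
  refine IsGreatest.csSup_eq ⟨h, fun k hk => ?_⟩
  by_contra hlt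
  exact absurd ((monotone_jumpTime ω (Nat.lt_iff_add_one_le.1 (not_le.1 hlt))).trans hk)
    (not_le.2 h')

/-- The integral of a function of state and age up to the `n`-th jump splits into the cycles. It
holds for every path: before `T_n` there are at most `n` jumps, so explosion plays no role. -/
theorem setLIntegral_Iio_jumpTime (f : S → ℝ≥0 → ℝ≥0∞) (n : ℕ) :
    ∫⁻ t in Iio (jumpTime ω n), f (stateAt ω t) (ageAt ω t) ∂leb
      = ∑ k ∈ Finset.range n, ∫⁻ s in Iio (ω (k + 1)).2, f (ω k).1 s ∂leb := by
  induction n with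
  | zero =>
    have : Iio (jumpTime ω 0) = ∅ := by
      ext t; simp [jumpTime]
    simp [this]
  | succ n ih =>
    have hle : jumpTime ω n ≤ jumpTime ω (n + 1) := monotone_jumpTime ω n.le_succ
    rw [Finset.sum_range_succ, ← ih, ← Iio_union_Ico_eq_Iio hle,
      lintegral_union measurableSet_Ico (by
        rw [Set.disjoint_left]; exact fun t h1 h2 => absurd h2.1 (not_le.2 h1))]
    congr 1
    rw [← setLIntegral_Ico_sub _ (jumpTime ω n), ← jumpTime_succ]
    refine setLIntegral_congr_fun measurableSet_Ico fun t ht => ?_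
    simp only [stateAt, ageAt, jumpCount_eq ω ht.1 ht.2]

end Path

/-- The density with hazard rate `q` has tail `exp(-∫_0^s q)` beyond `s`: the shifted hazard rate
`q(s + ·)` again has total mass one. -/
theorem setLIntegral_Ioi_hazard {q : ℝ≥0 → ℝ≥0∞} (hq : Measurable q) {m K : ℝ≥0} (hm : 0 < m)
    (hmq : ∀ t, (m : ℝ≥0∞) ≤ q t) (hqK : ∀ t, q t ≤ K) (s : ℝ≥0) :
    ∫⁻ t in Ioi s, ENNReal.ofReal (Real.exp (-(∫⁻ u in Iio t, q u ∂leb).toReal)) * q t ∂leb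
      = ENNReal.ofReal (Real.exp (-(∫⁻ u in Iio s, q u ∂leb).toReal)) := by
  have hfin : ∀ (q' : ℝ≥0 → ℝ≥0∞) (_ : ∀ t, q' t ≤ K) (t : ℝ≥0),
      ∫⁻ u in Iio t, q' u ∂leb ≠ ⊤ := fun q' h t => by
    refine ((lintegral_mono h).trans_lt ?_).ne
    rw [lintegral_const, Measure.restrict_apply_univ, leb_Iio]
    exact ENNReal.mul_lt_top ENNReal.coe_lt_top ENNReal.coe_lt_top
  have hsplit : ∀ t, ∫⁻ u in Iio (s + t), q u ∂leb
      = ∫⁻ u in Iio s, q u ∂leb + ∫⁻ u in Iio t, q (s + u) ∂leb := fun t => by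
    rw [← Iio_union_Ico_eq_Iio (self_le_add_right s t), lintegral_union measurableSet_Ico (by
        rw [Set.disjoint_left]; exact fun t h1 h2 => absurd h2.1 (not_le.2 h1)),
      ← setLIntegral_Ico_sub (fun u => q (s + u)) s t]
    congr 1
    refine setLIntegral_congr_fun measurableSet_Ico fun u hu => ?_
    simp only [add_tsub_cancel_of_le hu.1]
  rw [setLIntegral_congr Ioi_ae_eq_Ici, setLIntegral_Ici_leb]
  have h1 := lintegral_hazard (q := fun t => q (s + t)) (hq.comp (measurable_const_add s)) hm
    (fun t => hmq _) (fun t => hqK _)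
  rw [← mul_one (ENNReal.ofReal _), ← h1, ← lintegral_const_mul' _ _ ENNReal.ofReal_ne_top]
  refine lintegral_congr fun t => ?_
  rw [hsplit, ENNReal.toReal_add (hfin q hqK s) (hfin _ (fun u => hqK _) t), neg_add, Real.exp_add,
    ENNReal.ofReal_mul (Real.exp_pos _).le, mul_assoc]

namespace Model

section

variable {S U : Type*} [Countable S] [MeasurableSpace S] [MeasurableSpace U]
  (M : Model S U) (i : S) (r : Action U)

omit [Countable S] in
theorem lintegral_jumpLaw {f : S × ℝ≥0 → ℝ≥0∞} (hf : Measurable f) :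
    ∫⁻ z, f z ∂(M.jumpLaw i r) = ∑' j : {j : S // j ≠ i},
      ∫⁻ t, M.survival i r t * M.meanRate i j r t * f (j.1, t) ∂leb := by
  rw [jumpLaw, lintegral_sum_measure]
  congr 1
  ext j
  rw [lintegral_map hf measurable_prodMk_left]
  exact lintegral_withDensity_eq_lintegral_mul _
    ((M.measurable_survival i r).mul (M.measurable_meanRate i r j))
    (hf.comp measurable_prodMk_left)

theorem lintegral_jumpLaw_snd {f : ℝ≥0 → ℝ≥0∞} (hf : Measurable f) :
    ∫⁻ z, f z.2 ∂(M.jumpLaw i r)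
      = ∫⁻ t, M.survival i r t * M.meanExitRate i r t * f t ∂leb := by
  rw [lintegral_jumpLaw M i r (f := fun z => f z.2) (hf.comp measurable_snd),
    ← lintegral_tsum (f := fun (j : {j : S // j ≠ i}) t =>
      M.survival i r t * M.meanRate i j r t * f t) fun j =>
      (((M.measurable_survival i r).mul (M.measurable_meanRate i r j)).mul hf).aemeasurable]
  refine lintegral_congr fun t => ?_
  rw [ENNReal.tsum_mul_right, ENNReal.tsum_mul_left, ← meanExitRate_eq_tsum]

/-- Tonelli's theorem for an integral up to the sojourn time `τ`, whose tail is
`P(τ > s) = survival s`. -/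
theorem lintegral_jumpLaw_setLIntegral_Iio {f : ℝ≥0 → ℝ≥0∞} (hf : Measurable f) :
    ∫⁻ z, (∫⁻ s in Iio z.2, f s ∂leb) ∂(M.jumpLaw i r) = ∫⁻ s, M.survival i r s * f s ∂leb := by
  obtain ⟨m, K, hm0, -, hm, hK⟩ := M.exists_rate_bounds
  have hmeas : Measurable fun p : ℝ≥0 × ℝ≥0 => (Iio p.1).indicator f p.2 :=
    Measurable.ite (measurableSet_lt measurable_snd measurable_fst) (hf.comp measurable_snd)
      measurable_const
  have hd : Measurable fun t => M.survival i r t * M.meanExitRate i r t :=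
    (M.measurable_survival i r).mul (M.measurable_meanExitRate i r)
  simp_rw [← lintegral_indicator measurableSet_Iio]
  rw [lintegral_jumpLaw_snd M i r (f := fun t => ∫⁻ s, (Iio t).indicator f s ∂leb)
    hmeas.lintegral_prod_right']
  have h1 : ∀ t, M.survival i r t * M.meanExitRate i r t * ∫⁻ s, (Iio t).indicator f s ∂leb
      = ∫⁻ s, M.survival i r t * M.meanExitRate i r t * (Iio t).indicator f s ∂leb := fun t =>
    (lintegral_const_mul _ (hmeas.comp measurable_prodMk_left)).symm
  simp_rw [h1]
  rw [lintegral_lintegral_swap (((hd.comp measurable_fst).mul hmeas).aemeasurable)]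
  refine lintegral_congr fun s => ?_
  have h2 : M.survival i r s
      = ∫⁻ t, (Ioi s).indicator (fun t => M.survival i r t * M.meanExitRate i r t) t ∂leb := by
    rw [lintegral_indicator measurableSet_Ioi]
    exact (setLIntegral_Ioi_hazard (M.measurable_meanExitRate i r) hm0
      (le_meanExitRate r (hm i)) (meanExitRate_le r (hK i)) s).symm
  rw [h2, ← lintegral_mul_const _ (hd.indicator measurableSet_Ioi)]
  refine lintegral_congr fun t => ?_
  by_cases h : s < t <;> simp [indicator, h]

theorem integral_jumpLaw_fst [DiscreteMeasurableSpace S] {ψ : S → ℝ} {B : ℝ}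
    (hB : ∀ j, |ψ j| ≤ B) :
    ∫ z, ψ z.1 ∂(M.jumpLaw i r) = ∑' j : {j : S // j ≠ i}, (M.transProb i j r).toReal * ψ j := by
  have := M.isProbabilityMeasure_jumpLaw i r
  have hm : Measurable fun z : S × ℝ≥0 => ψ z.1 := (measurable_of_countable ψ).comp measurable_fst
  have hI : Integrable (fun z : S × ℝ≥0 => ψ z.1) (M.jumpLaw i r) :=
    Integrable.of_bound hm.aestronglyMeasurable B (Eventually.of_forall fun z => hB _)
  have h := (hasSum_integral_measure hI).tsum_eq
  rw [jumpLaw, ← h]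
  congr 1
  ext j
  rw [integral_map measurable_prodMk_left.aemeasurable hm.aestronglyMeasurable]
  simp only [integral_const, measureReal_def, withDensity_apply _ MeasurableSet.univ,
    Measure.restrict_univ, smul_eq_mul]
  rfl

end

end Model

/-! ### Expectations along the embedded chain -/

namespace Model

variable {S U : Type*} [Countable S] [MeasurableSpace S] [DiscreteMeasurableSpace S]
  [MeasurableSpace U] (M : Model S U) (u : Control S U) (i : S)

instance : IsProbabilityMeasure (M.law u i) := by
  rw [law]; infer_instance

/-- The Markov property of the jump chain: the next entry has the law `jumpKernel` of the current
state. -/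
theorem map_law_eq (n : ℕ) :
    (M.law u i).map (Preorder.frestrictLe n) ⊗ₘ
      ((M.jumpKernel u).comap (fun x : (k : Finset.Iic n) → S × ℝ≥0 =>
        (x ⟨n, Finset.mem_Iic.2 le_rfl⟩).1) (by fun_prop)) =
    (M.law u i).map fun ω => (Preorder.frestrictLe n ω, ω (n + 1)) :=
  Kernel.map_frestrictLe_trajMeasure_compProd_eq_map_trajMeasure
    (X := fun _ => S × ℝ≥0) (a := n)

theorem lintegral_law {F : S → S × ℝ≥0 → ℝ≥0∞} (hF : ∀ k, Measurable (F k)) (n : ℕ) :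
    ∫⁻ ω, F (ω n).1 (ω (n + 1)) ∂(M.law u i)
      = ∫⁻ ω, ∫⁻ z, F (ω n).1 z ∂(M.jumpLaw (ω n).1 (u.action (ω n).1)) ∂(M.law u i) := by
  have hF' : Measurable fun p : S × (S × ℝ≥0) => F p.1 p.2 :=
    measurable_from_prod_countable_right hF
  have hG : Measurable fun p : ((k : Finset.Iic n) → S × ℝ≥0) × (S × ℝ≥0) =>
      F (p.1 ⟨n, Finset.mem_Iic.2 le_rfl⟩).1 p.2 := hF'.comp
        (g := fun p : S × (S × ℝ≥0) => F p.1 p.2)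
        (f := fun p : ((k : Finset.Iic n) → S × ℝ≥0) × (S × ℝ≥0) =>
          ((p.1 ⟨n, Finset.mem_Iic.2 le_rfl⟩).1, p.2)) (by fun_prop)
  have h1 := lintegral_map (μ := M.law u i) hG
    (g := fun ω : ℕ → S × ℝ≥0 => (Preorder.frestrictLe (π := fun _ => S × ℝ≥0) n ω, ω (n + 1)))
    (by fun_prop)
  rw [← map_law_eq, Measure.lintegral_compProd hG,
    lintegral_map hG.lintegral_kernel_prod_right' (by fun_prop)] at h1
  exact h1.symm

theorem integral_law {ψ : S → ℝ} {B : ℝ} (hB : ∀ j, |ψ j| ≤ B) (n : ℕ) :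
    ∫ ω, ψ (ω (n + 1)).1 ∂(M.law u i) = ∫ ω, (∑' j : {j : S // j ≠ (ω n).1},
      (M.transProb (ω n).1 j (u.action (ω n).1)).toReal * ψ j) ∂(M.law u i) := by
  have hψ : Measurable ψ := measurable_of_countable ψ
  have hG : Measurable fun p : ((k : Finset.Iic n) → S × ℝ≥0) × (S × ℝ≥0) => ψ p.2.1 :=
    hψ.comp (by fun_prop)
  have h1 := integral_map (μ := M.law u i) (f := fun p : _ × (S × ℝ≥0) => ψ p.2.1)
    (φ := fun ω => (Preorder.frestrictLe n ω, ω (n + 1)))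
    (Measurable.aemeasurable (by fun_prop)) hG.aestronglyMeasurable
  have : IsProbabilityMeasure ((M.law u i).map (Preorder.frestrictLe (π := fun _ => S × ℝ≥0) n)) :=
    Measure.isProbabilityMeasure_map (Measurable.aemeasurable (by fun_prop))
  rw [← map_law_eq, Measure.integral_compProd (Integrable.of_bound hG.aestronglyMeasurable B
    (Eventually.of_forall fun _ => hB _)), integral_map (Measurable.aemeasurable (by fun_prop))
    hG.stronglyMeasurable.integral_kernel_prod_right'.aestronglyMeasurable] at h1
  refine h1.symm.trans (integral_congr_ae (Eventually.of_forall fun ω => ?_))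
  exact M.integral_jumpLaw_fst (ω n).1 (u.action (ω n).1) hB

theorem expectedTime_eq (n : ℕ) : M.expectedTime u i n = ∑ k ∈ Finset.range n,
    ∫⁻ ω, M.meanSojourn (ω k).1 (u.action (ω k).1) ∂(M.law u i) := by
  simp only [expectedTime, jumpTime, ENNReal.ofNNReal_finsetSum]
  rw [lintegral_finsetSum _ fun k _ => by fun_prop]
  refine Finset.sum_congr rfl fun k _ => ?_
  rw [M.lintegral_law u i (F := fun _ z => (z.2 : ℝ≥0∞)) (fun _ => by fun_prop) k]
  refine lintegral_congr fun ω => ?_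
  have := M.lintegral_jumpLaw_setLIntegral_Iio (ω k).1 (u.action (ω k).1) (f := fun _ => 1)
    measurable_const
  simpa [leb_Iio, meanSojourn] using this

omit [Countable S] [MeasurableSpace S] [DiscreteMeasurableSpace S] in
theorem measurable_meanCost (hc : ∀ i, Measurable fun p : ℝ≥0 × U => M.cost i p.1 p.2)
    (r : Action U) : Measurable (M.meanCost i r) :=
  Measurable.lintegral_kernel_prod_right (κ := r.1)
    (f := fun y v => (M.cost i y v : ℝ≥0∞)) (hc i).coe_nnreal_ennreal

theorem expectedCost_eq (hc : ∀ i, Measurable fun p : ℝ≥0 × U => M.cost i p.1 p.2) (n : ℕ) :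
    M.expectedCost u i n = ∑ k ∈ Finset.range n,
      ∫⁻ ω, M.stageCost (ω k).1 (u.action (ω k).1) ∂(M.law u i) := by
  have hm : ∀ k, Measurable fun z : S × ℝ≥0 =>
      ∫⁻ s in Iio z.2, M.meanCost k (u.action k) s ∂leb := fun k => by
    simp_rw [← lintegral_indicator measurableSet_Iio]
    have hmeas : Measurable fun p : (S × ℝ≥0) × ℝ≥0 =>
        (Iio p.1.2).indicator (M.meanCost k (u.action k)) p.2 :=
      Measurable.ite (measurableSet_lt measurable_snd (by fun_prop))
        ((M.measurable_meanCost k hc (u.action k)).comp measurable_snd) measurable_const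
    exact hmeas.lintegral_prod_right'
  have h1 : ∀ ω : ℕ → S × ℝ≥0, ∫⁻ t in Iio (jumpTime ω n),
      (∫⁻ v, (M.cost (stateAt ω t) (ageAt ω t) v : ℝ≥0∞) ∂(u.1 (stateAt ω t, ageAt ω t))) ∂leb
      = ∑ k ∈ Finset.range n, ∫⁻ s in Iio (ω (k + 1)).2,
        M.meanCost (ω k).1 (u.action (ω k).1) s ∂leb := fun ω =>
    setLIntegral_Iio_jumpTime ω (fun k y => M.meanCost k (u.action k) y) n
  have hm' : Measurable fun p : S × (S × ℝ≥0) =>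
      ∫⁻ s in Iio p.2.2, M.meanCost p.1 (u.action p.1) s ∂leb :=
    measurable_from_prod_countable_right hm
  simp only [expectedCost, h1]
  rw [lintegral_finsetSum (f := fun k (ω : ℕ → S × ℝ≥0) => ∫⁻ s in Iio (ω (k + 1)).2,
    M.meanCost (ω k).1 (u.action (ω k).1) s ∂leb) _ fun k _ => hm'.comp (by fun_prop :
    Measurable fun ω : ℕ → S × ℝ≥0 => ((ω k).1, ω (k + 1)))]
  refine Finset.sum_congr rfl fun k _ => ?_
  rw [M.lintegral_law u i hm k]
  refine lintegral_congr fun ω => ?_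
  exact M.lintegral_jumpLaw_setLIntegral_Iio (ω k).1 (u.action (ω k).1)
    (M.measurable_meanCost _ hc _)

end Model

/-! ### Average cost of a control -/

namespace Model

variable {S U : Type*} [Countable S] [MeasurableSpace S] [DiscreteMeasurableSpace S]
  [MeasurableSpace U] (M : Model S U)

omit [Countable S] [MeasurableSpace S] [DiscreteMeasurableSpace S] in
theorem stageCost_le {C : ℝ≥0} (hC : ∀ i y v, M.cost i y v ≤ C) (i : S) (r : Action U) :
    M.stageCost i r ≤ C * M.meanSojourn i r := by
  rw [stageCost, meanSojourn, ← lintegral_const_mul _ (M.measurable_survival i r)]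
  refine lintegral_mono fun t => ?_
  rw [mul_comm (C : ℝ≥0∞)]
  gcongr
  have := lintegral_mono (μ := r.1 t) (f := fun v => (M.cost i t v : ℝ≥0∞)) (g := fun _ => C)
    (fun v => ENNReal.coe_le_coe.2 (hC i t v))
  simpa [meanCost] using this

theorem lintegral_law_eq_ofReal (u : Control S U) (i : S) {f : S → ℝ≥0∞} {C : ℝ≥0}
    (hf : ∀ k, f k ≤ C) (n : ℕ) :
    ∫⁻ ω, f (ω n).1 ∂(M.law u i) = ENNReal.ofReal (∫ ω, (f (ω n).1).toReal ∂(M.law u i)) := by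
  have hm : Measurable fun ω : ℕ → S × ℝ≥0 => f (ω n).1 :=
    (measurable_of_countable f).comp (by fun_prop)
  have hlt : ∀ k, f k < ⊤ := fun k => (hf k).trans_lt ENNReal.coe_lt_top
  rw [integral_toReal hm.aemeasurable (Eventually.of_forall fun ω => hlt _), ENNReal.ofReal_toReal]
  refine ((lintegral_mono fun ω : ℕ → S × ℝ≥0 => hf (ω n).1).trans_lt ?_).ne
  simp

theorem integrable_law (u : Control S U) (i : S) {f : S → ℝ} {C : ℝ} (hf : ∀ k, |f k| ≤ C)
    (n : ℕ) : Integrable (fun ω : ℕ → S × ℝ≥0 => f (ω n).1) (M.law u i) :=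
  Integrable.of_bound ((measurable_of_countable f).comp (by fun_prop)).aestronglyMeasurable C
    (Eventually.of_forall fun ω => hf _)

/-- The renewal reward identity. The expected cost `A n` and time `T n` up to the `n`-th jump and
the expectation `b n` of `ψ(X_n)` are finite, `T n` grows at least linearly, and
`A n - ρ T n + b n - b 0` is the sum of the expected gaps `bracket - ψ` along the chain. -/
theorem exists_expectations (u : Control S U) (i : S)
    (hc : ∀ i, Measurable fun p : ℝ≥0 × U => M.cost i p.1 p.2) {C : ℝ≥0}
    (hC : ∀ i y v, M.cost i y v ≤ C) {ψ : S → ℝ} {B : ℝ} (hB : ∀ j, |ψ j| ≤ B) (ρ : ℝ) :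
    ∃ (A T b : ℕ → ℝ) (K : ℝ), 0 < K ∧ (∀ n, M.expectedCost u i n = ENNReal.ofReal (A n)) ∧
      (∀ n, M.expectedTime u i n = ENNReal.ofReal (T n)) ∧ (∀ n, 0 ≤ A n) ∧
      (∀ n : ℕ, (n : ℝ) ≤ K * T n) ∧ (∀ n, |b n| ≤ B) ∧
      ∀ n, A n - ρ * T n + b n - b 0 = ∑ k ∈ Finset.range n,
        ∫ ω, (M.bracket ψ ρ (ω k).1 (u.action (ω k).1) - ψ (ω k).1) ∂(M.law u i) := by
  obtain ⟨m, K, hm0, hmK, hm, hK⟩ := M.exists_rate_bounds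
  have hτ : ∀ k, M.meanSojourn k (u.action k) ≤ (m⁻¹ : ℝ≥0) := fun k => by
    rw [ENNReal.coe_inv hm0.ne', ENNReal.le_inv_iff_mul_le, mul_comm]
    exact mul_meanSojourn_le _ (hm k)
  have hφ : ∀ k, M.stageCost k (u.action k) ≤ (C * m⁻¹ : ℝ≥0) := fun k => by
    rw [ENNReal.coe_mul]
    exact (M.stageCost_le hC k _).trans (by gcongr; exact hτ k)
  have habs : ∀ {x : ℝ≥0∞} {c : ℝ≥0}, x ≤ c → |x.toReal| ≤ c := fun {x c} h => by
    rw [abs_of_nonneg ENNReal.toReal_nonneg]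
    exact ENNReal.toReal_mono ENNReal.coe_ne_top h
  let τ : S → ℝ := fun k => (M.meanSojourn k (u.action k)).toReal
  let φ : S → ℝ := fun k => (M.stageCost k (u.action k)).toReal
  let η : S → ℝ := fun k =>
    ∑' j : {j : S // j ≠ k}, (M.transProb k j (u.action k)).toReal * ψ j
  have hη : ∀ k, |η k| ≤ B := fun k => by
    have := M.isProbabilityMeasure_jumpLaw k (u.action k)
    simp only [η]
    rw [← M.integral_jumpLaw_fst k (u.action k) hB]
    have h := norm_integral_le_of_norm_le_const (μ := M.jumpLaw k (u.action k))
      (f := fun z => ψ z.1) (C := B) (Eventually.of_forall fun z => hB _)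
    simpa using h
  have hτi := fun k => M.integrable_law u i (f := τ) (fun k => habs (hτ k)) k
  have hφi := fun k => M.integrable_law u i (f := φ) (fun k => habs (hφ k)) k
  have hηi := fun k => M.integrable_law u i (f := η) hη k
  have hψi := fun k => M.integrable_law u i (f := ψ) hB k
  refine ⟨fun n => ∑ k ∈ Finset.range n, ∫ ω, φ (ω k).1 ∂(M.law u i),
    fun n => ∑ k ∈ Finset.range n, ∫ ω, τ (ω k).1 ∂(M.law u i),
    fun n => ∫ ω, ψ (ω n).1 ∂(M.law u i), K, by exact_mod_cast hm0.trans hmK,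
    fun n => ?_, fun n => ?_, fun n => ?_, fun n => ?_, fun n => ?_, fun n => ?_⟩
  · rw [M.expectedCost_eq u i hc, ENNReal.ofReal_sum_of_nonneg fun k _ =>
      integral_nonneg fun ω => ENNReal.toReal_nonneg]
    exact Finset.sum_congr rfl fun k _ => M.lintegral_law_eq_ofReal u i hφ k
  · rw [M.expectedTime_eq u i, ENNReal.ofReal_sum_of_nonneg fun k _ =>
      integral_nonneg fun ω => ENNReal.toReal_nonneg]
    exact Finset.sum_congr rfl fun k _ => M.lintegral_law_eq_ofReal u i hτ k
  · exact Finset.sum_nonneg fun k _ => integral_nonneg fun ω => ENNReal.toReal_nonneg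
  · rw [Finset.mul_sum]
    refine le_trans (by simp) (Finset.sum_le_sum (f := fun _ => (1 : ℝ)) fun k _ => ?_)
    rw [← integral_const_mul]
    refine le_trans (by simp) (integral_mono (f := fun _ => (1 : ℝ)) (integrable_const _)
      ((hτi k).const_mul _) fun ω => ?_)
    have h := one_le_mul_meanSojourn (u.action (ω k).1) (hK (ω k).1)
    have h' := ENNReal.toReal_mono (ENNReal.mul_ne_top ENNReal.coe_ne_top
      (M.meanSojourn_ne_top _ _)) h
    simpa [ENNReal.toReal_mul] using h'
  · have h := norm_integral_le_of_norm_le_const (μ := M.law u i)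
      (f := fun ω => ψ (ω n).1) (C := B) (Eventually.of_forall fun ω => hB _)
    simpa using h
  · -- with `b n - b 0` as a telescoping sum, the identity is checked cycle by cycle
    rw [add_sub_assoc, ← Finset.sum_range_sub (fun n => ∫ ω, ψ (ω n).1 ∂(M.law u i)),
      Finset.mul_sum, ← Finset.sum_sub_distrib, ← Finset.sum_add_distrib]
    refine Finset.sum_congr rfl fun k _ => ?_
    have e : ∫ ω, (φ (ω k).1 + η (ω k).1 - ρ * τ (ω k).1 - ψ (ω k).1) ∂(M.law u i)
        = ∫ ω, φ (ω k).1 ∂(M.law u i) + ∫ ω, η (ω k).1 ∂(M.law u i)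
          - ρ * ∫ ω, τ (ω k).1 ∂(M.law u i) - ∫ ω, ψ (ω k).1 ∂(M.law u i) := by
      rw [integral_sub (by exact ((hφi k).add (hηi k)).sub ((hτi k).const_mul ρ)) (hψi k),
        integral_sub (by exact (hφi k).add (hηi k)) ((hτi k).const_mul ρ),
        integral_add (hφi k) (hηi k), integral_const_mul]
    rw [M.integral_law u i hB k]
    refine Eq.trans ?_ e.symm
    ring

theorem tendsto_const_div_of_le {T b : ℕ → ℝ} {K B : ℝ} (hK : 0 < K)
    (hT : ∀ n : ℕ, (n : ℝ) ≤ K * T n) (hb : ∀ n, |b n| ≤ B) :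
    Tendsto (fun n => b n / T n) atTop (𝓝 0) := by
  have hTt : Tendsto T atTop atTop := by
    refine tendsto_atTop_mono (f := fun n : ℕ => (n : ℝ) / K) (fun n => ?_)
      (tendsto_natCast_atTop_atTop.atTop_div_const hK)
    rw [div_le_iff₀' hK]
    exact hT n
  exact Tendsto.zero_mul_isBoundedUnder_le (hTt.inv_tendsto_atTop)
    (isBoundedUnder_of ⟨B, fun n => hb n⟩) |>.congr fun n => by
      simp [div_eq_inv_mul]

/-- A control whose actions satisfy the inequality `ψ ≤ bracket` costs at least `ρ`. -/
theorem averageCost_ge (hc : ∀ i, Measurable fun p : ℝ≥0 × U => M.cost i p.1 p.2) {C : ℝ≥0}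
    (hC : ∀ i y v, M.cost i y v ≤ C) {ψ : S → ℝ} {B : ℝ} (hB : ∀ j, |ψ j| ≤ B) {ρ : ℝ}
    (u : Control S U) (hu : ∀ i, ψ i ≤ M.bracket ψ ρ i (u.action i)) (i : S) :
    ENNReal.ofReal ρ ≤ M.averageCost u i := by
  obtain ⟨A, T, b, K, hK, hA, hT, hA0, hTn, hb, hsum⟩ := M.exists_expectations u i hc hC hB ρ
  have hpos : ∀ n, 0 < n → 0 < T n := fun n hn =>
    pos_of_mul_pos_right ((Nat.cast_pos.2 hn).trans_le (hTn n)) hK.le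
  have hlim : Tendsto (fun n => ENNReal.ofReal (ρ + (b 0 - b n) / T n)) atTop
      (𝓝 (ENNReal.ofReal ρ)) := by
    refine (ENNReal.continuous_ofReal.tendsto _).comp ?_
    simpa using (tendsto_const_nhds (x := ρ)).add (tendsto_const_div_of_le hK hTn
      (b := fun n => b 0 - b n) (B := B + B) fun n => (abs_sub _ _).trans
        (add_le_add (hb 0) (hb n)))
  rw [← hlim.limsup_eq, averageCost]
  refine limsup_le_limsup ?_
  filter_upwards [eventually_gt_atTop 0] with n hn
  have h0 : 0 ≤ A n - ρ * T n + b n - b 0 := by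
    rw [hsum]
    exact Finset.sum_nonneg fun k _ => integral_nonneg fun ω => sub_nonneg.2 (hu _)
  rw [hA, hT, ← ENNReal.ofReal_div_of_pos (hpos n hn)]
  refine ENNReal.ofReal_le_ofReal ?_
  rw [le_div_iff₀ (hpos n hn), add_mul, div_mul_cancel₀ _ (hpos n hn).ne']
  linarith

/-- A control whose actions attain `ψ = bracket` costs exactly `ρ`, which is then nonnegative as a
limit of ratios of nonnegative expectations. -/
theorem averageCost_eq (hc : ∀ i, Measurable fun p : ℝ≥0 × U => M.cost i p.1 p.2) {C : ℝ≥0}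
    (hC : ∀ i y v, M.cost i y v ≤ C) {ψ : S → ℝ} {B : ℝ} (hB : ∀ j, |ψ j| ≤ B) {ρ : ℝ}
    (u : Control S U) (hu : ∀ i, M.bracket ψ ρ i (u.action i) = ψ i) (i : S) :
    0 ≤ ρ ∧ M.averageCost u i = ENNReal.ofReal ρ := by
  obtain ⟨A, T, b, K, hK, hA, hT, hA0, hTn, hb, hsum⟩ := M.exists_expectations u i hc hC hB ρ
  have hpos : ∀ n, 0 < n → 0 < T n := fun n hn =>
    pos_of_mul_pos_right ((Nat.cast_pos.2 hn).trans_le (hTn n)) hK.le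
  have hlim : Tendsto (fun n => A n / T n) atTop (𝓝 ρ) := by
    have h := (tendsto_const_nhds (x := ρ)).add (tendsto_const_div_of_le hK hTn
      (b := fun n => b 0 - b n) (B := B + B) fun n => (abs_sub _ _).trans
        (add_le_add (hb 0) (hb n)))
    rw [add_zero] at h
    refine h.congr' ?_
    filter_upwards [eventually_gt_atTop 0] with n hn
    have h0 : A n - ρ * T n + b n - b 0 = 0 := by
      rw [hsum]
      simp [hu]
    have := (hpos n hn).ne'
    field_simp
    linarith
  refine ⟨ge_of_tendsto' hlim fun n => ?_, ?_⟩
  · exact div_nonneg (hA0 n) (by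
      have := (Nat.cast_nonneg n).trans (hTn n)
      exact nonneg_of_mul_nonneg_right this hK)
  refine Tendsto.limsup_eq (((ENNReal.continuous_ofReal.tendsto _).comp hlim).congr' ?_)
  filter_upwards [eventually_gt_atTop 0] with n hn
  rw [hA, hT, ← ENNReal.ofReal_div_of_pos (hpos n hn)]
  rfl

end Model

end AgeControl

theorem mainTheorem2 {S U : Type*} [Countable S] [MeasurableSpace S] [DiscreteMeasurableSpace S]
    [MetricSpace U] [CompactSpace U] [Nonempty U] [MeasurableSpace U] [BorelSpace U]
    (M : AgeControl.Model S U) (hrate : M.ContinuousRates) (hcost : M.ContinuousBoundedCost)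
    (h : S → ℝ) (g : ℝ) (hbdd : ∃ B : ℝ, ∀ i, |h i| ≤ B) (hsol : M.IsSolution h g) :
    (∀ i, (M.optimalCost i : EReal) = (g : EReal)) ∧
    (∃ r : S → AgeControl.Action U, ∀ i, M.IsMinimizer h g i (r i)) ∧
    (∀ r : S → AgeControl.Action U, (∀ i, M.IsMinimizer h g i (r i)) →
      M.IsAverageOptimal (AgeControl.Control.ofActions r)) := by
  obtain ⟨B, hB⟩ := hbdd
  obtain ⟨C, hC⟩ := hcost.2.2
  have hc := AgeControl.Model.measurable_cost hcost
  have hex : ∃ r : S → AgeControl.Action U, ∀ i, M.IsMinimizer h g i (r i) :=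
    ⟨fun i => (AgeControl.Model.exists_isMinimizer hrate hcost hB g i).choose,
      fun i => (AgeControl.Model.exists_isMinimizer hrate hcost hB g i).choose_spec⟩
  have hlow : ∀ i, ENNReal.ofReal g ≤ M.optimalCost i := fun i =>
    le_iInf fun u => M.averageCost_ge hc hC hB u (fun i => (hsol i).1 (mem_range_self _)) i
  have hopt : ∀ r : S → AgeControl.Action U, (∀ i, M.IsMinimizer h g i (r i)) → ∀ i,
      0 ≤ g ∧ M.averageCost (AgeControl.Control.ofActions r) i = ENNReal.ofReal g := by
    refine fun r hr => M.averageCost_eq hc hC hB _ fun i => ?_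
    exact le_antisymm ((hsol i).2 (forall_mem_range.2 (hr i))) ((hsol i).1 (mem_range_self _))
  have heq : ∀ i, M.optimalCost i = ENNReal.ofReal g := fun i => by
    obtain ⟨r, hr⟩ := hex
    exact le_antisymm ((iInf_le _ _).trans_eq (hopt r hr i).2) (hlow i)
  refine ⟨fun i => ?_, hex, fun r hr i => ?_⟩
  · obtain ⟨r, hr⟩ := hex
    rw [heq, EReal.coe_ennreal_ofReal, max_eq_left (hopt r hr i).1]
  · rw [heq, (hopt r hr i).2]
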